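/- Let $f\in\Gamma_0(\mathbb R^n)$ and $g\in\Gamma_0(\mathbb R^m)$ be proper, lower semicontinuous, convex functions with values in $\mathbb R\cup\{+\infty\}$, and let $\mathcal A:\mathbb R^n\to\mathbb R^m$ be a (possibly nonlinear) mapping. Let $$L(x,y)=f(x)+\langle \mathcal A(x),y\rangle-g^*(y)$$ be the Lagrangian, with $L(x,y)=+\infty$ whenever $f(x)=+\infty$, and assume that $L(\cdot,y)$ is convex for every $y\in\mathbb R^m$. Let $\psi(y)=-\inf_{x}L(x,y)$ be the negative dual function. Let $p\ge 1$, $\lambda>0$, $r\in\{2,p+1\}$, $\phi=\frac1{p+1}\|\cdot\|_r^{p+1}$ on $\mathbb R^m$ with convex conjugate $\phi^*$, $(\lambda\star\phi)(u)=\lambda\phi(\lambda^{-1}u)$, and let $$L_\lambda(x,y)=\sup_{\eta\in\mathbb R^m}\; L(x,\eta)-(\lambda\star\phi)(y-\eta)$$ be the augmented Lagrangian. Then $\phi^*$ is finite and differentiable on $\mathbb R^m$, and for each $x\in\operatorname{dom} f$ so is $L_\lambda(x,\cdot)$. Let $\varepsilon\ge 0$, $x^+\in\mathbb R^n$, $y\in\mathbb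 R^m$ and $$y^+=y+\lambda\nabla\phi^*(\nabla_yL_\lambda(x^+,y)).$$ (i) If $L(x^+,y^+)\le\inf_x L(x,y^+)+\varepsilon$, then $x^+\in\operatorname{dom} f$ and $-\nabla_yL_\lambda(x^+,y)\in\partial_\varepsilon\psi(y^+)$; that is, $\psi(y^+)$ is finite and $\psi(z)\ge\psi(y^+)-\langle\nabla_yL_\lambda(x^+,y),z-y^+\rangle-\varepsilon$ for all $z\in\mathbb R^m$. (ii) If $L_\lambda(x^+,y)\le\inf_x L_\lambda(x,y)+\varepsilon$, then $x^+\in\operatorname{dom} f$ and $y^+$ is a $2^{p-1}\varepsilon$-proximal point of $\psi$ at $y$; that is, $\psi+(\lambda\star\phi)(y-\cdot)$ has a unique minimizer $z$ on $\mathbb R^m$, and $(\lambda\star\phi)(y^+-z)\le 2^{p-1}\varepsilon$. (iii) Suppose that $\operatorname{dom} f$ is bounded, with Euclidean diameter $D=\sup_{x,x'\in\operatorname{dom} f}\|x-x'\|_2$, and let $e\in\partial_xL_\lambda(x^+,y)$ (the subdifferential of convex analysis of $L_\lambda(\cdot,y)$ at $x^+$) satisfy $\|e\|_2\le\varepsilon/D$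 (no condition on $e$ if $D=0$). Then the hypotheses of (i) and of (ii) both hold. (In (i) and (ii) the hypothesis can only hold if $x^+\in\operatorname{dom} f$, and in (iii) $x^+\in\operatorname{dom} f$ because $L_\lambda(x^+,y)$ is finite where its subdifferential is nonempty; so the gradients that define $y^+$ exist in all three cases.) -/

import Mathlib

namespace PowerALM

/-- The effective domain of an extended real-valued function. -/
def dom {E : Type*} (h : E → EReal) : Set E := {x | h x < ⊤}

/-- Convexity of an extended real-valued function, through its epigraph. -/
def ConvexFun {E : Type*} [AddCommGroup E] [Module ℝ E] (h : E → EReal) : Prop :=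
  Convex ℝ {z : E × ℝ | h z.1 ≤ (z.2 : EReal)}

/-- Proper, lower semicontinuous, convex functions with values in `ℝ ∪ {+∞}`. -/
structure IsGammaZero {E : Type*} [AddCommGroup E] [Module ℝ E] [TopologicalSpace E]
    (h : E → EReal) : Prop where
  ne_bot : ∀ x, h x ≠ ⊥
  proper : (dom h).Nonempty
  lsc : LowerSemicontinuous h
  convex : ConvexFun h

section Hilbert

variable {E : Type*} [NormedAddCommGroup E] [InnerProductSpace ℝ E]

/-- The convex conjugate `h*(v) = sup_u ⟨u, v⟩ - h(u)`. -/
noncomputable def conj (h : E → EReal) (v : E) : EReal :=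
  ⨆ u : E, ((inner ℝ u v : ℝ) : EReal) - h u

/-- The `ε`-subdifferential of `h` at a point `x` where `h` is finite. -/
def epsSubdiff (ε : ℝ) (h : E → EReal) (x : E) : Set E :=
  {v | h x ≠ ⊤ ∧ h x ≠ ⊥ ∧
    ∀ z, h x + ((inner ℝ v (z - x) - ε : ℝ) : EReal) ≤ h z}

/-- The subdifferential of convex analysis of `h` at a point `x` where `h` is finite. -/
def subdiff (h : E → EReal) (x : E) : Set E :=
  {v | h x ≠ ⊤ ∧ h x ≠ ⊥ ∧
    ∀ z, h x + ((inner ℝ v (z - x) : ℝ) : EReal) ≤ h z}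

end Hilbert

/-- The `r`-norm on `ℝᵐ` (used for `r ≥ 1`). -/
noncomputable def rNorm {m : ℕ} (r : ℝ) (u : EuclideanSpace ℝ (Fin m)) : ℝ :=
  (∑ i, |u i| ^ r) ^ (1 / r)

/-- The prox-function `φ = (1 / (p + 1)) ‖·‖_r ^ (p + 1)`. -/
noncomputable def phi {m : ℕ} (p r : ℝ) (u : EuclideanSpace ℝ (Fin m)) : ℝ :=
  (1 / (p + 1)) * rNorm r u ^ (p + 1)

/-- The convex conjugate `φ*` of the prox-function. -/
noncomputable def phiConj {m : ℕ} (p r : ℝ) (v : EuclideanSpace ℝ (Fin m)) : EReal :=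
  conj (fun u => (phi p r u : EReal)) v

/-- The epi-scaling `(lam ⋆ φ)(u) = lam * φ(lam⁻¹ u)` of `φ`, for `lam > 0`. -/
noncomputable def epiPhi {m : ℕ} (p r lam : ℝ) (u : EuclideanSpace ℝ (Fin m)) : ℝ :=
  lam * phi p r (lam⁻¹ • u)

/-- The anisotropic proximal mapping: the set of minimizers of `ψ + (lam ⋆ φ)(y - ·)`. -/
noncomputable def aprox {m : ℕ} (p r lam : ℝ) (ψ : EuclideanSpace ℝ (Fin m) → EReal)
    (y : EuclideanSpace ℝ (Fin m)) : Set (EuclideanSpace ℝ (Fin m)) :=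
  {z | ∀ η, ψ z + (epiPhi p r lam (y - z) : EReal) ≤ ψ η + (epiPhi p r lam (y - η) : EReal)}

/-- `w` is a `δ`-proximal point of `ψ` at `y`: the proximal point `z` of `ψ` at `y` exists, is
unique, and `(lam ⋆ φ)(w - z) ≤ δ`. -/
def IsEpsProximalPoint {m : ℕ} (p r lam δ : ℝ) (ψ : EuclideanSpace ℝ (Fin m) → EReal)
    (y w : EuclideanSpace ℝ (Fin m)) : Prop :=
  ∃ z, aprox p r lam ψ y = {z} ∧ epiPhi p r lam (w - z) ≤ δ

section Problem

variable {n m : ℕ} (f : EuclideanSpace ℝ (Fin n) → EReal)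
  (g : EuclideanSpace ℝ (Fin m) → EReal)
  (A : EuclideanSpace ℝ (Fin n) → EuclideanSpace ℝ (Fin m))

open Classical in
/-- The Lagrangian `L(x, y) = f(x) + ⟨A(x), y⟩ - g*(y)`. As usual it is `+∞` for `x ∉ dom f`,
even where `g*(y) = +∞`; this is the value of `inf_u f(x) + g(A(x) + u) - ⟨y, u⟩`. -/
noncomputable def lagr (x : EuclideanSpace ℝ (Fin n)) (y : EuclideanSpace ℝ (Fin m)) : EReal :=
  if f x = ⊤ then ⊤ else f x + ((inner ℝ (A x) y : ℝ) : EReal) - conj g y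

/-- The Lagrange dual function `ϱ(y) = inf_x L(x, y)`. -/
noncomputable def dualFun (y : EuclideanSpace ℝ (Fin m)) : EReal :=
  ⨅ x, lagr f g A x y

/-- The negative dual function `ψ = -ϱ`. -/
noncomputable def negDual (y : EuclideanSpace ℝ (Fin m)) : EReal :=
  - dualFun f g A y

/-- The augmented Lagrangian `L_lam(x, y) = sup_η L(x, η) - (lam ⋆ φ)(y - η)`. -/
noncomputable def augLagr (p r lam : ℝ) (x : EuclideanSpace ℝ (Fin n))
    (y : EuclideanSpace ℝ (Fin m)) : EReal :=
  ⨆ η, lagr f g A x η - (epiPhi p r lam (y - η) : EReal)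

/-- The gradient `∇_y L_lam(x, y)`. -/
noncomputable def gradAugLagr (p r lam : ℝ) (x : EuclideanSpace ℝ (Fin n))
    (y : EuclideanSpace ℝ (Fin m)) : EuclideanSpace ℝ (Fin m) :=
  gradient (fun z => (augLagr f g A p r lam x z).toReal) y

/-- The dual update `y + lam ∇φ*(∇_y L_lam(x, y))`. -/
noncomputable def dualUpdate (p r lam : ℝ) (x : EuclideanSpace ℝ (Fin n))
    (y : EuclideanSpace ℝ (Fin m)) : EuclideanSpace ℝ (Fin m) :=
  y + lam • gradient (fun v => (phiConj p r v).toReal) (gradAugLagr f g A p r lam x y)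

end Problem

end PowerALM

namespace PowerALM

/-! ### Strong monotonicity and Bregman bounds for powers of the norm. -/

section NormPower

/-! Everything rests on one property of ω = lam ⋆ φ: its Bregman distance dominates 2^(1-p) ω. Since
`negLagr x` is closed and convex in η, the supremum defining L_lam(x, y) is attained at a single
point s(x), and moving to η costs at least 2^(1-p) ω(η - s(x)) (`IsProxPoint.growth`). An envelope
argument gives ∇_y L_lam(x, y) = -∇φ(lam⁻¹(y - s(x))). As ∇φ is odd with inverse ∇φ*, the update y⁺
is exactly s(x⁺) (`IsDualUpdate.dualUpdate_eq`).

(i) Optimality of s(x⁺) makes -∇_y L_lam a subgradient of -L(x⁺, ·) at y⁺. The function ψ dominates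
-L(x⁺, ·) and exceeds it by at most ε at y⁺.

(ii) Let β = inf_x L_lam(x, y). The minimax theorem `existsUnique_saddle` gives z with L(x, z) - ω(y
- z) ≥ β for all x; this z is the proximal point. Growth at x⁺ then reads β + 2^(1-p) ω(y⁺ - z) ≤
L_lam(x⁺, y) ≤ β + ε.

(iii) For the Lagrangian tilted by -⟨e, ·⟩, x⁺ is an exact minimizer, so growth forces z = y⁺. Hence
e is also a subgradient of L(·, y⁺) at x⁺, and Cauchy–Schwarz on the bounded domain yields both
ε-minimality claims. -/

lemma add_rpow_le_mul_add {a b s : ℝ} (ha : 0 ≤ a) (hb : 0 ≤ b) (hs : 1 ≤ s) :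
    (a + b) ^ s ≤ 2 ^ (s - 1) * (a ^ s + b ^ s) := by
  lift a to NNReal using ha
  lift b to NNReal using hb
  exact_mod_cast NNReal.rpow_add_le_mul_rpow_add_rpow a b hs

lemma rpow_sub_two_mul_self {s q : ℝ} (hs : 0 ≤ s) (hq : 2 ≤ q) :
    s ^ (q - 2) * s = s ^ (q - 1) := by
  rw [← Real.rpow_add_one' hs (by linarith)]
  congr 1; ring

lemma rpow_sub_one_mul_self {s q : ℝ} (hs : 0 ≤ s) (hq : 2 ≤ q) :
    s ^ (q - 1) * s = s ^ q := by
  rw [← Real.rpow_add_one' hs (by linarith)]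
  congr 1; ring

lemma sq_rpow_half {s : ℝ} (hs : 0 ≤ s) (q : ℝ) : (s ^ 2) ^ (q / 2) = s ^ q := by
  rw [← Real.rpow_natCast, ← Real.rpow_mul hs]
  congr 1; push_cast; ring

/-- The scalar inequality behind the strong monotonicity of the gradient of `‖·‖ ^ q / q`. -/
lemma two_rpow_mul_rpow_le {s t q N : ℝ} (ht : 0 ≤ t) (hts : t ≤ s) (hq : 2 ≤ q)
    (h₁ : (s - t) ^ 2 ≤ N) (h₂ : N ≤ (s + t) ^ 2) :
    2 ^ (2 - q) * N ^ (q / 2) ≤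
      (s ^ (q - 2) + t ^ (q - 2)) / 2 * N + (s ^ (q - 2) - t ^ (q - 2)) / 2 * (s ^ 2 - t ^ 2) := by
  have hs : 0 ≤ s := ht.trans hts
  set S := s ^ (q - 2) with hS
  set T := t ^ (q - 2) with hT
  have hSs : S * s = s ^ (q - 1) := rpow_sub_two_mul_self hs hq
  have hTt : T * t = t ^ (q - 1) := rpow_sub_two_mul_self ht hq
  have h2pos : (0 : ℝ) < 2 ^ (2 - q) := by positivity
  -- For fixed s and t, the difference of the two sides is convex in N, so only the endpoints N = (s
  -- ∓ t)² matter; they correspond to collinear vectors.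
  have hconv : ConvexOn ℝ (Set.Ici (0 : ℝ)) (fun N : ℝ => 2 ^ (2 - q) * N ^ (q / 2) +
      (-((S + T) / 2) * N + -((S - T) / 2 * (s ^ 2 - t ^ 2)))) := by
    refine ((convexOn_rpow (by linarith : 1 ≤ q / 2)).smul h2pos.le).add ?_
    refine ⟨convex_Ici 0, fun x _ y _ a b _ _ hab => le_of_eq ?_⟩
    simp only [smul_eq_mul]
    linear_combination ((S - T) / 2 * (s ^ 2 - t ^ 2)) * hab
  have key := hconv.le_max_of_mem_Icc (x := (s - t) ^ 2) (y := (s + t) ^ 2) (z := N)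
    (Set.mem_Ici.2 (sq_nonneg _)) (Set.mem_Ici.2 (sq_nonneg _)) ⟨h₁, h₂⟩
  -- Parallel vectors: superadditivity of the power q - 1.
  have e₁ : 2 ^ (2 - q) * ((s - t) ^ 2) ^ (q / 2) ≤
      (S + T) / 2 * (s - t) ^ 2 + (S - T) / 2 * (s ^ 2 - t ^ 2) := by
    rw [sq_rpow_half (by linarith), ← rpow_sub_one_mul_self (by linarith) hq]
    have h1 : (2 : ℝ) ^ (2 - q) ≤ 1 :=
      Real.rpow_le_one_of_one_le_of_nonpos (by norm_num) (by linarith)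
    have h2 : (s - t) ^ (q - 1) + t ^ (q - 1) ≤ (s - t + t) ^ (q - 1) :=
      Real.add_rpow_le_rpow_add (by linarith) ht (by linarith)
    rw [sub_add_cancel] at h2
    have h3 : 0 ≤ (s - t) ^ (q - 1) * (s - t) :=
      mul_nonneg (Real.rpow_nonneg (by linarith) _) (by linarith)
    have h4 : (S + T) / 2 * (s - t) ^ 2 + (S - T) / 2 * (s ^ 2 - t ^ 2) =
        (s ^ (q - 1) - t ^ (q - 1)) * (s - t) := by rw [← hSs, ← hTt]; ring
    rw [h4]
    calc _ ≤ (s - t) ^ (q - 1) * (s - t) := mul_le_of_le_one_left h3 h1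
      _ ≤ _ := mul_le_mul_of_nonneg_right (by linarith) (by linarith)
  -- Antiparallel vectors: the power mean inequality. Equality at s = t shows that 2^(2-q) is sharp.
  have e₂ : 2 ^ (2 - q) * ((s + t) ^ 2) ^ (q / 2) ≤
      (S + T) / 2 * (s + t) ^ 2 + (S - T) / 2 * (s ^ 2 - t ^ 2) := by
    rw [sq_rpow_half (by linarith), ← rpow_sub_one_mul_self (by linarith) hq]
    have h2 := add_rpow_le_mul_add hs ht (by linarith : 1 ≤ q - 1)
    have h4 : (S + T) / 2 * (s + t) ^ 2 + (S - T) / 2 * (s ^ 2 - t ^ 2) =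
        (s ^ (q - 1) + t ^ (q - 1)) * (s + t) := by rw [← hSs, ← hTt]; ring
    rw [h4, ← mul_assoc]
    refine mul_le_mul_of_nonneg_right ?_ (by linarith)
    calc _ ≤ 2 ^ (2 - q) * (2 ^ (q - 1 - 1) * (s ^ (q - 1) + t ^ (q - 1))) :=
          mul_le_mul_of_nonneg_left h2 h2pos.le
      _ = 2 ^ ((2 - q) + (q - 1 - 1)) * (s ^ (q - 1) + t ^ (q - 1)) := by
          rw [Real.rpow_add (by norm_num)]; ring
      _ = _ := by
          rw [show (2 - q) + (q - 1 - 1) = 0 by ring, Real.rpow_zero, one_mul]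
  have := max_le (c := (0 : ℝ)) (by linarith) (by linarith) |> key.trans
  linarith

variable {E : Type*} [NormedAddCommGroup E] [InnerProductSpace ℝ E]

/-- By polarization the inner product depends only on ‖a‖, ‖b‖ and N = ‖a - b‖², and the triangle
inequality confines N to the range of `two_rpow_mul_rpow_le`. -/
lemma rpow_norm_sub_le_inner {q : ℝ} (hq : 2 ≤ q) (a b : E) :
    2 ^ (2 - q) * ‖a - b‖ ^ q ≤
      inner ℝ (‖a‖ ^ (q - 2) • a - ‖b‖ ^ (q - 2) • b) (a - b) := by
  wlog h : ‖b‖ ≤ ‖a‖ generalizing a b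
  · have := this b a (le_of_not_ge h)
    rw [norm_sub_rev] at this
    refine this.trans_eq ?_
    rw [← neg_sub (‖a‖ ^ (q - 2) • a), ← neg_sub a b, inner_neg_neg]
  have key := two_rpow_mul_rpow_le (norm_nonneg b) h hq (N := ‖a - b‖ ^ 2)
    (by
      have := norm_sub_norm_le a b
      have h0 : 0 ≤ ‖a‖ - ‖b‖ := by linarith
      gcongr)
    (by gcongr; exact norm_sub_le a b)
  rw [sq_rpow_half (norm_nonneg _)] at key
  refine key.trans_eq ?_
  rw [@norm_sub_sq_real, inner_sub_left, inner_sub_right, inner_sub_right]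
  simp only [real_inner_smul_left, real_inner_self_eq_norm_sq, real_inner_comm a b]
  rw [real_inner_comm b a]
  ring

variable [CompleteSpace E]

lemma hasGradientAt_norm_rpow_div {q : ℝ} (hq : 2 ≤ q) (u : E) :
    HasGradientAt (fun u : E => 1 / q * ‖u‖ ^ q) (‖u‖ ^ (q - 2) • u) u := by
  rw [hasGradientAt_iff_hasFDerivAt]
  refine ((hasFDerivAt_norm_rpow u (by linarith : 1 < q)).const_mul (1 / q)).congr_fderiv ?_
  ext v
  have : q ≠ 0 := by linarith
  simp
  field_simp

lemma hasDerivAt_comp_line {φ : E → ℝ} {v b d : E} {t : ℝ} (h : HasGradientAt φ v (b + t • d)) :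
    HasDerivAt (fun t : ℝ => φ (b + t • d)) (inner ℝ v d) t := by
  have h1 : HasDerivAt (fun t : ℝ => b + t • d) d t := by
    simpa using ((hasDerivAt_id t).smul_const d).const_add b
  exact (hasGradientAt_iff_hasFDerivAt.1 h).comp_hasDerivAt t h1

/-- Strong monotonicity of a gradient yields a lower bound of the Bregman distance. -/
lemma bregman_of_monotone {φ : E → ℝ} {dφ : E → E} {q c : ℝ} (hq : 1 < q)
    (hgrad : ∀ u, HasGradientAt φ (dφ u) u)
    (hmono : ∀ a b, c * ‖a - b‖ ^ q ≤ inner ℝ (dφ a - dφ b) (a - b)) (a b : E) :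
    φ b + inner ℝ (dφ b) (a - b) + c * (1 / q * ‖a - b‖ ^ q) ≤ φ a := by
  set d := a - b with hd
  -- The gap in the claim along the segment from b to a. Monotonicity between b + t d and b says
  -- that t h'(t) ≥ 0; the result is h 0 ≤ h 1.
  let h : ℝ → ℝ := fun t => φ (b + t • d) - t * inner ℝ (dφ b) d - c * ‖d‖ ^ q * (1 / q * t ^ q)
  have hq0 : q ≠ 0 := by linarith
  have hder : ∀ t : ℝ, HasDerivAt h
      (inner ℝ (dφ (b + t • d)) d - inner ℝ (dφ b) d - c * ‖d‖ ^ q * t ^ (q - 1)) t := by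
    intro t
    have h1 := hasDerivAt_comp_line (hgrad (b + t • d))
    have h2 : HasDerivAt (fun t : ℝ => t * inner ℝ (dφ b) d) (inner ℝ (dφ b) d) t := by
      simpa using (hasDerivAt_id t).mul_const (inner ℝ (dφ b) d)
    have h3 := ((Real.hasDerivAt_rpow_const (x := t) (p := q) (Or.inr hq.le)).const_mul
      (1 / q)).const_mul (c * ‖d‖ ^ q)
    refine ((h1.sub h2).sub h3).congr_deriv ?_
    field_simp
  have hmon : MonotoneOn h (Set.Ici 0) := by
    refine monotoneOn_of_deriv_nonneg (convex_Ici 0)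
      (fun t _ => (hder t).continuousAt.continuousWithinAt)
      (fun t _ => (hder t).differentiableAt.differentiableWithinAt) fun t ht => ?_
    rw [interior_Ici, Set.mem_Ioi] at ht
    rw [(hder t).deriv]
    have := hmono (b + t • d) b
    rw [add_sub_cancel_left, norm_smul, Real.norm_of_nonneg ht.le,
      Real.mul_rpow ht.le (norm_nonneg _), real_inner_smul_right, inner_sub_left] at this
    have e : t ^ q = t ^ (q - 1) * t := by
      rw [← Real.rpow_add_one ht.ne']; congr 1; ring
    rw [e] at this
    refine nonneg_of_mul_nonneg_right (b := _) (a := t) ?_ ht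
    nlinarith
  have := hmon (a := 0) (b := 1) (by simp) (by simp) zero_le_one
  have e0 : (0 : ℝ) ^ q = 0 := Real.zero_rpow hq0
  simp only [h, zero_smul, add_zero, zero_mul, sub_zero, e0, mul_zero, one_smul, one_mul,
    Real.one_rpow, mul_one] at this
  have e1 : b + d = a := by rw [hd]; abel
  rw [e1] at this
  linarith

end NormPower

/-- Even differentiable functions with a Bregman distance bounded from below by the function
itself, and of power growth. -/
structure IsProxFunction {E : Type*} [NormedAddCommGroup E] [InnerProductSpace ℝ E]
    [CompleteSpace E] (φ : E → ℝ) (dφ : E → E) (σ : ℝ) : Prop where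
  zero : φ 0 = 0
  even : ∀ u, φ (-u) = φ u
  pos : 0 < σ
  grad : ∀ u, HasGradientAt φ (dφ u) u
  bregman : ∀ a b, φ b + inner ℝ (dφ b) (a - b) + σ * φ (a - b) ≤ φ a
  coercive : ∃ c q : ℝ, 0 < c ∧ 2 ≤ q ∧ ∀ u, c * ‖u‖ ^ q ≤ φ u

/-! ### The prox-function for r = 2 and r = p + 1. -/

section Phi

lemma isProxFunction_norm_rpow {E : Type*} [NormedAddCommGroup E] [InnerProductSpace ℝ E]
    [CompleteSpace E] {q : ℝ} (hq : 2 ≤ q) :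
    IsProxFunction (fun u : E => 1 / q * ‖u‖ ^ q) (fun u => ‖u‖ ^ (q - 2) • u) (2 ^ (2 - q)) where
  zero := by
    have : q ≠ 0 := by linarith
    simp [Real.zero_rpow this]
  even u := by simp
  pos := by positivity
  grad := hasGradientAt_norm_rpow_div hq
  bregman := bregman_of_monotone (by linarith) (hasGradientAt_norm_rpow_div hq)
    (rpow_norm_sub_le_inner hq)
  coercive := ⟨1 / q, q, by positivity, hq, fun u => le_rfl⟩

variable {m : ℕ}

lemma norm_rpow_le_sum {q : ℝ} (hq : 2 ≤ q) (u : EuclideanSpace ℝ (Fin m)) :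
    ‖u‖ ^ q ≤ (m : ℝ) ^ (q / 2 - 1) * ∑ i, |u i| ^ q := by
  have h := Real.rpow_sum_le_const_mul_sum_rpow Finset.univ (fun i => u i ^ 2)
    (by linarith : 1 ≤ q / 2)
  have e : ∀ i, |u i ^ 2| ^ (q / 2) = |u i| ^ q := fun i => by
    rw [abs_pow, sq_rpow_half (abs_nonneg _)]
  have e' : (∑ i, |u i ^ 2|) = ‖u‖ ^ 2 := by
    rw [EuclideanSpace.norm_sq_eq]
    simp
  simpa only [e, e', sq_rpow_half (norm_nonneg _), Finset.card_univ, Fintype.card_fin] using h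

lemma isProxFunction_sum_rpow {q : ℝ} (hq : 2 ≤ q) :
    IsProxFunction (fun u : EuclideanSpace ℝ (Fin m) => ∑ i, 1 / q * |u i| ^ q)
      (fun u => WithLp.toLp 2 fun i => |u i| ^ (q - 2) * u i) (2 ^ (2 - q)) where
  zero := by
    have : q ≠ 0 := by linarith
    simp [Real.zero_rpow this]
  even u := by simp
  pos := by positivity
  grad u := by
    rw [hasGradientAt_iff_hasFDerivAt]
    have h : ∀ i ∈ Finset.univ, HasFDerivAt
        (fun u : EuclideanSpace ℝ (Fin m) => 1 / q * |u i| ^ q)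
        ((InnerProductSpace.toDual ℝ ℝ (‖u i‖ ^ (q - 2) • u i)).comp
          (EuclideanSpace.proj i : EuclideanSpace ℝ (Fin m) →L[ℝ] ℝ)) u := fun i _ =>
      HasFDerivAt.comp (g := fun x : ℝ => 1 / q * |x| ^ q) u
        (hasGradientAt_iff_hasFDerivAt.1 (hasGradientAt_norm_rpow_div (E := ℝ) hq (u i)))
        (EuclideanSpace.proj i : EuclideanSpace ℝ (Fin m) →L[ℝ] ℝ).hasFDerivAt
    refine (HasFDerivAt.fun_sum h).congr_fderiv ?_
    ext v
    simp [PiLp.inner_apply]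
  bregman a b := by
    simp only [PiLp.inner_apply, Finset.mul_sum, ← Finset.sum_add_distrib]
    refine Finset.sum_le_sum fun i _ => ?_
    simpa [mul_comm] using (isProxFunction_norm_rpow (E := ℝ) hq).bregman (a i) (b i)
  coercive := by
    have hm : (0 : ℝ) ≤ (m : ℝ) ^ (q / 2 - 1) := by positivity
    have hq0 : 0 < q := by linarith
    -- The `+ 1` keeps the constant positive when m = 0.
    refine ⟨1 / (q * ((m : ℝ) ^ (q / 2 - 1) + 1)), q, by positivity, hq, fun u => ?_⟩
    have h := norm_rpow_le_sum hq u
    have hs : 0 ≤ ∑ i, |u i| ^ q := Finset.sum_nonneg fun i _ => by positivity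
    rw [← Finset.mul_sum, one_div_mul_eq_div, one_div_mul_eq_div, div_le_div_iff₀ (by positivity)
      hq0]
    nlinarith

/-- The gradient of the prox-function. -/
noncomputable def gradPhi (p r : ℝ) (u : EuclideanSpace ℝ (Fin m)) : EuclideanSpace ℝ (Fin m) :=
  gradient (phi p r) u

lemma IsProxFunction.eq_gradient {E : Type*} [NormedAddCommGroup E] [InnerProductSpace ℝ E]
    [CompleteSpace E] {φ : E → ℝ} {dφ : E → E} {σ : ℝ} (h : IsProxFunction φ dφ σ) :
    dφ = gradient φ :=
  funext fun u => (h.grad u).gradient.symm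

/-- With q = p + 1, φ is a power of the Euclidean norm for r = 2 and a separable sum for r = p + 1.
Both have modulus 2^(2-q) = 2^(1-p), the source of the factor 2^(p-1) in (ii). -/
lemma isProxFunction_phi {p r : ℝ} (hp : 1 ≤ p) (hr : r = 2 ∨ r = p + 1) :
    IsProxFunction (phi p r : EuclideanSpace ℝ (Fin m) → ℝ) (gradPhi p r) (2 ^ (1 - p)) := by
  suffices h : ∃ dφ, IsProxFunction (phi p r : EuclideanSpace ℝ (Fin m) → ℝ) dφ (2 ^ (1 - p)) by
    obtain ⟨dφ, h⟩ := h
    have := h.eq_gradient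
    rwa [this] at h
  rw [show 1 - p = 2 - (p + 1) by ring]
  rcases hr with rfl | rfl
  · refine ⟨fun u => ‖u‖ ^ (p + 1 - 2) • u, ?_⟩
    · convert isProxFunction_norm_rpow (E := EuclideanSpace ℝ (Fin m))
        (by linarith : 2 ≤ p + 1) using 1
      funext u
      rw [phi, rNorm, EuclideanSpace.norm_eq, Real.sqrt_eq_rpow]
      simp
  · refine ⟨fun u => WithLp.toLp 2 fun i => |u i| ^ (p + 1 - 2) * u i, ?_⟩
    · convert isProxFunction_sum_rpow (m := m) (by linarith : 2 ≤ p + 1) using 1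
      funext u
      rw [phi, rNorm, ← Real.rpow_mul (Finset.sum_nonneg fun i _ => by positivity),
        one_div_mul_cancel (by linarith), Real.rpow_one, Finset.mul_sum]

end Phi

/-! ### Epi-scaling, symmetry and growth of prox-functions. -/

section Scaling

variable {E : Type*} [NormedAddCommGroup E] [InnerProductSpace ℝ E] [CompleteSpace E]
  {φ : E → ℝ} {dφ : E → E} {σ : ℝ}

lemma IsProxFunction.epiScale (h : IsProxFunction φ dφ σ) {lam : ℝ} (hlam : 0 < lam) :
    IsProxFunction (fun u => lam * φ (lam⁻¹ • u)) (fun u => dφ (lam⁻¹ • u)) σ where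
  zero := by simp [h.zero]
  even u := by simp [h.even]
  pos := h.pos
  grad u := by
    have h1 := hasGradientAt_iff_hasFDerivAt.1 (h.grad (lam⁻¹ • u))
    have h2 : HasFDerivAt (fun u : E => lam⁻¹ • u) (lam⁻¹ • ContinuousLinearMap.id ℝ E) u :=
      (lam⁻¹ • ContinuousLinearMap.id ℝ E).hasFDerivAt
    rw [hasGradientAt_iff_hasFDerivAt]
    refine ((HasFDerivAt.comp (f := fun u : E => lam⁻¹ • u) u h1 h2).const_mul
      lam).congr_fderiv ?_
    ext v
    simp [hlam.ne']
  bregman a b := by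
    have := mul_le_mul_of_nonneg_left (h.bregman (lam⁻¹ • a) (lam⁻¹ • b)) hlam.le
    rw [← smul_sub, real_inner_smul_right] at this
    refine le_trans (le_of_eq ?_) this
    field_simp
  coercive := by
    obtain ⟨c, q, hc, hq, hcq⟩ := h.coercive
    refine ⟨lam * (c * lam⁻¹ ^ q), q, by positivity, hq, fun u => ?_⟩
    have := mul_le_mul_of_nonneg_left (hcq (lam⁻¹ • u)) hlam.le
    rw [norm_smul, Real.norm_of_nonneg (by positivity),
      Real.mul_rpow (by positivity) (norm_nonneg _)] at this
    linarith

lemma IsProxFunction.nonneg (h : IsProxFunction φ dφ σ) (u : E) : 0 ≤ φ u := by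
  obtain ⟨c, q, hc, hq, hcq⟩ := h.coercive
  exact le_trans (by positivity) (hcq u)

lemma IsProxFunction.eq_of_le_zero (h : IsProxFunction φ dφ σ) {u : E} (hu : φ u ≤ 0) :
    u = 0 := by
  obtain ⟨c, q, hc, hq, hcq⟩ := h.coercive
  by_contra hne
  have : 0 < ‖u‖ := norm_pos_iff.2 hne
  have : 0 < c * ‖u‖ ^ q := by positivity
  linarith [hcq u]

lemma IsProxFunction.continuous (h : IsProxFunction φ dφ σ) : Continuous φ :=
  continuous_iff_continuousAt.2 fun u => (h.grad u).continuousAt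

lemma IsProxFunction.grad_neg (h : IsProxFunction φ dφ σ) (u : E) : dφ (-u) = -dφ u := by
  have h1 := hasGradientAt_iff_hasFDerivAt.1 (h.grad (- -u))
  have h2 := HasFDerivAt.comp (f := fun v : E => -v) (-u) h1 (hasFDerivAt_id (𝕜 := ℝ) (-u)).neg
  have h3 : HasGradientAt φ (-dφ u) (-u) := by
    rw [hasGradientAt_iff_hasFDerivAt]
    refine (h2.congr_fderiv ?_).congr_of_eventuallyEq
      (Filter.Eventually.of_forall fun v => (h.even v).symm)
    ext v; simp
  exact (h.grad (-u)).unique h3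

/-- Away from the origin, a prox-function is bounded from below by a multiple of the norm. -/
lemma IsProxFunction.exists_mul_norm_le (h : IsProxFunction φ dφ σ) {ρ : ℝ} (hρ : 0 < ρ) :
    ∃ κ > 0, ∀ u, ρ ≤ ‖u‖ → κ * ‖u‖ ≤ φ u := by
  obtain ⟨c, q, hc, hq, hcq⟩ := h.coercive
  refine ⟨c * ρ ^ (q - 1), by positivity, fun u hu => le_trans ?_ (hcq u)⟩
  rw [← rpow_sub_one_mul_self (norm_nonneg u) hq, ← mul_assoc]
  have : ρ ^ (q - 1) ≤ ‖u‖ ^ (q - 1) := Real.rpow_le_rpow hρ.le hu (by linarith)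
  gcongr

/-- Prox-functions have superlinear growth. -/
lemma IsProxFunction.isBounded (h : IsProxFunction φ dφ σ) (C M : ℝ) :
    Bornology.IsBounded {u | φ u ≤ C + M * ‖u‖} := by
  obtain ⟨c, q, hc, hq, hcq⟩ := h.coercive
  refine (Metric.isBounded_closedBall (x := (0 : E))
    (r := max 1 ((|C| + |M|) / c))).subset fun u hu => ?_
  rw [mem_closedBall_zero_iff]
  by_contra! hlt
  have h1 : 1 < ‖u‖ := (le_max_left _ _).trans_lt hlt
  have h2 : (|C| + |M|) / c < ‖u‖ := (le_max_right _ _).trans_lt hlt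
  rw [div_lt_iff₀ hc] at h2
  have h3 : ‖u‖ ^ (2 : ℝ) ≤ ‖u‖ ^ q := Real.rpow_le_rpow_of_exponent_le h1.le hq
  rw [Real.rpow_two] at h3
  have h4 : c * ‖u‖ ^ 2 ≤ C + M * ‖u‖ :=
    (mul_le_mul_of_nonneg_left h3 hc.le).trans ((hcq u).trans hu)
  have h5 : C ≤ |C| * ‖u‖ := (le_abs_self C).trans (le_mul_of_one_le_right (abs_nonneg _) h1.le)
  have h6 : M * ‖u‖ ≤ |M| * ‖u‖ := mul_le_mul_of_nonneg_right (le_abs_self M) (norm_nonneg _)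
  nlinarith

end Scaling

/-! ### Proximal points and differentiability of the envelope. -/

section Prox

variable {E : Type*} [NormedAddCommGroup E] [InnerProductSpace ℝ E]

/-- A real-valued function on a nonempty set `K` which is convex, closed, and has an affine
minorant: the real-valued form of a function in `Γ₀(E)` with effective domain `K`. -/
structure IsClosedConvexOn (K : Set E) (k : E → ℝ) : Prop where
  nonempty : K.Nonempty
  convexOn : ConvexOn ℝ K k
  isClosed : ∀ θ : E → ℝ, Continuous θ → IsClosed {η | η ∈ K ∧ k η ≤ θ η}
  minorant : ∃ (u : E) (c : ℝ), ∀ η ∈ K, inner ℝ u η + c ≤ k η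

lemma IsClosedConvexOn.sub_affine {K : Set E} {k : E → ℝ} (h : IsClosedConvexOn K k)
    (a : E) (b : ℝ) : IsClosedConvexOn K (fun η => k η - (b + inner ℝ a η)) where
  nonempty := h.nonempty
  convexOn := by
    refine ⟨h.convexOn.1, fun x hx y hy s t hs ht hst => ?_⟩
    have := h.convexOn.2 hx hy hs ht hst
    simp only [smul_eq_mul, inner_add_right, real_inner_smul_right] at this ⊢
    linear_combination this + b * hst
  isClosed θ hθ := by
    have := h.isClosed (fun η => θ η + (b + inner ℝ a η)) (by fun_prop)
    simpa only [sub_le_iff_le_add] using this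
  minorant := by
    obtain ⟨u, c, hu⟩ := h.minorant
    refine ⟨u - a, c - b, fun η hη => ?_⟩
    rw [inner_sub_left]
    linarith [hu η hη]

/-- First-order optimality condition for `z` to minimize `k + φ(y - ·)` over `K`, where `dφ` is
the gradient of `φ`. -/
def IsProxPoint (K : Set E) (k : E → ℝ) (dφ : E → E) (y z : E) : Prop :=
  z ∈ K ∧ ∀ η ∈ K, k z + inner ℝ (dφ (y - z)) (η - z) ≤ k η

variable [CompleteSpace E] {K : Set E} {k φ : E → ℝ} {dφ : E → E} {σ : ℝ} {y z : E}

/-- Add the optimality condition to the Bregman bound at y - z: the linear terms cancel and the term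
with σ survives. -/
lemma IsProxPoint.growth (hφ : IsProxFunction φ dφ σ) (hz : IsProxPoint K k dφ y z) {η : E}
    (hη : η ∈ K) : k z + φ (y - z) + σ * φ (η - z) ≤ k η + φ (y - η) := by
  have h1 := hz.2 η hη
  have h2 := hφ.bregman (y - η) (y - z)
  rw [show y - η - (y - z) = -(η - z) by abel, hφ.even, inner_neg_right] at h2
  linarith

/-- Compare z with (1 - t) z + t η, bound k by convexity, divide by t and let t → 0⁺. -/
lemma IsProxPoint.of_isMin (hφ : IsProxFunction φ dφ σ) (hk : ConvexOn ℝ K k) (hz : z ∈ K)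
    (hmin : ∀ η ∈ K, k z + φ (y - z) ≤ k η + φ (y - η)) : IsProxPoint K k dφ y z := by
  refine ⟨hz, fun η hη => ?_⟩
  have hd : HasDerivAt (fun t : ℝ => φ (y - z + t • (z - η))) (inner ℝ (dφ (y - z)) (z - η)) 0 :=
    hasDerivAt_comp_line (by simpa using hφ.grad (y - z))
  have hlim := hd.tendsto_slope_zero_right
  have hle : -(k η - k z) ≤ inner ℝ (dφ (y - z)) (z - η) := by
    refine ge_of_tendsto hlim ?_
    have h1 : ∀ᶠ t : ℝ in nhdsWithin 0 (Set.Ioi 0), t ≤ 1 :=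
      nhdsWithin_le_nhds (Iic_mem_nhds one_pos)
    filter_upwards [self_mem_nhdsWithin, h1] with t ht0 ht1
    rw [Set.mem_Ioi] at ht0
    have hc := hk.2 hz hη (by linarith : 0 ≤ 1 - t) ht0.le (by ring)
    have hm := hmin _ (hk.1 hz hη (by linarith : 0 ≤ 1 - t) ht0.le (by ring))
    rw [show y - ((1 - t) • z + t • η) = y - z + t • (z - η) by module] at hm
    simp only [smul_eq_mul, zero_add, zero_smul, add_zero] at hc ⊢
    rw [le_inv_mul_iff₀ ht0]
    linarith
  rw [← neg_sub η z, inner_neg_right] at hle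
  linarith

/-- A function with closed and bounded superlevel sets attains its maximum. -/
lemma exists_isMax_of_isClosed {E : Type*} [PseudoMetricSpace E] [ProperSpace E] {K : Set E}
    {F : E → ℝ} (hK : K.Nonempty)
    (hcl : ∀ c : ℝ, IsClosed {η | η ∈ K ∧ c ≤ F η})
    (hbd : ∀ c : ℝ, Bornology.IsBounded {η | η ∈ K ∧ c ≤ F η}) :
    ∃ z ∈ K, ∀ η ∈ K, F η ≤ F z := by
  have : Nonempty K := hK.to_subtype
  obtain ⟨z, hz⟩ := IsCompact.nonempty_iInter_of_directed_nonempty_isCompact_isClosed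
    (fun η' : K => {η | η ∈ K ∧ F η' ≤ F η})
    (fun a b => by
      rcases le_total (F a) (F b) with h | h
      · exact ⟨b, fun η hη => ⟨hη.1, h.trans hη.2⟩, subset_rfl⟩
      · exact ⟨a, subset_rfl, fun η hη => ⟨hη.1, h.trans hη.2⟩⟩)
    (fun η' => ⟨η', η'.2, le_rfl⟩)
    (fun η' => Metric.isCompact_of_isClosed_isBounded (hcl _) (hbd _)) (fun η' => hcl _)
  rw [Set.mem_iInter] at hz
  exact ⟨z, (hz (Classical.arbitrary K)).1, fun η hη => (hz ⟨η, hη⟩).2⟩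

lemma IsClosedConvexOn.exists_isProxPoint [ProperSpace E] (hk : IsClosedConvexOn K k)
    (hφ : IsProxFunction φ dφ σ) (y : E) : ∃ z, IsProxPoint K k dφ y z := by
  obtain ⟨u, c₀, hu⟩ := hk.minorant
  obtain ⟨z, hz, hmax⟩ := exists_isMax_of_isClosed (K := K) (F := fun η => -(k η + φ (y - η)))
    hk.nonempty
    (fun c => by
      have hc := hφ.continuous
      convert hk.isClosed (fun η => -c - φ (y - η)) (by fun_prop) using 3 with η
      exact and_congr_right fun _ => ⟨fun h => by linarith, fun h => by linarith⟩)
    -- The superlinear growth of φ beats the affine minorant of k.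
    (fun c => by
      have hb := hφ.isBounded (-c - c₀ + ‖u‖ * ‖y‖) ‖u‖
      obtain ⟨R, hR⟩ := hb.subset_closedBall 0
      refine (Metric.isBounded_closedBall (x := y) (r := R)).subset fun η hη => ?_
      rw [mem_closedBall_iff_norm, norm_sub_rev, ← mem_closedBall_zero_iff]
      refine hR ?_
      have h1 := hu η hη.1
      have h2 : -inner ℝ u η = inner ℝ u (y - η) - inner ℝ u y := by rw [inner_sub_right]; ring
      have h3 := real_inner_le_norm u (y - η)
      have h4 := (abs_le.1 (abs_real_inner_le_norm u y)).1
      have h5 := hη.2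
      change φ (y - η) ≤ _
      linarith)
  exact ⟨z, .of_isMin hφ hk.convexOn hz fun η hη => by linarith [hmax η hη]⟩

/-- The error of e against its proposed tangent is nonpositive and no larger in absolute value than
that of `lo`. -/
lemma hasGradientAt_of_sandwich {e lo : E → ℝ} {v y : E} (hlo : HasGradientAt lo v y)
    (hy : lo y = e y) (h₁ : ∀ y', lo y' ≤ e y') (h₂ : ∀ y', e y' ≤ e y + inner ℝ v (y' - y)) :
    HasGradientAt e v y := by
  rw [hasGradientAt_iff_isLittleO] at hlo ⊢
  refine (Asymptotics.IsBigO.of_bound 1 (Filter.Eventually.of_forall fun y' => ?_)).trans_isLittleO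
    hlo
  rw [one_mul, Real.norm_eq_abs, Real.norm_eq_abs]
  have := h₁ y'
  have := h₂ y'
  rw [abs_of_nonpos (by linarith), abs_of_nonpos (by linarith)]
  linarith

/-- The negative Moreau envelope is differentiable. -/
lemma IsProxPoint.hasGradientAt (hφ : IsProxFunction φ dφ σ) {e : E → ℝ}
    (he : ∀ y', ∃ z', IsProxPoint K k dφ y' z' ∧ e y' = -(k z' + φ (y' - z')))
    (hz : IsProxPoint K k dφ y z) : HasGradientAt e (-dφ (y - z)) y := by
  have hge : ∀ y', ∀ η ∈ K, -(k η + φ (y' - η)) ≤ e y' := fun y' η hη => by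
    obtain ⟨z', hz', h'⟩ := he y'
    have := hz'.growth hφ hη
    have := mul_nonneg hφ.pos.le (hφ.nonneg (η - z'))
    linarith
  have hey : e y = -(k z + φ (y - z)) := by
    refine le_antisymm ?_ (hge y z hz.1)
    obtain ⟨z', hz', h'⟩ := he y
    have := hz.growth hφ hz'.1
    have := mul_nonneg hφ.pos.le (hφ.nonneg (z' - z))
    linarith
  -- The smooth minorant freezes the maximizer z; it touches e at y.
  refine hasGradientAt_of_sandwich (lo := fun y' => -(k z + φ (y' - z))) ?_ hey.symm
    (fun y' => hge y' z hz.1) fun y' => ?_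
  · have h1 := hasGradientAt_iff_hasFDerivAt.1 (hφ.grad (y - z))
    have h2 := (((HasFDerivAt.comp (f := fun y : E => y - z) y h1
      ((hasFDerivAt_id (𝕜 := ℝ) y).sub_const z))).const_add (k z)).neg
    rw [hasGradientAt_iff_hasFDerivAt]
    refine h2.congr_fderiv ?_
    ext v
    simp
  -- The tangent lies above e: add the optimality of z tested at z' to the Bregman bound at y - z.
  · obtain ⟨z', hz', h'⟩ := he y'
    have h1 := hz.2 z' hz'.1
    have h2 := hφ.bregman (y' - z') (y - z)
    have h3 := mul_nonneg hφ.pos.le (hφ.nonneg (y' - z' - (y - z)))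
    rw [show y' - z' - (y - z) = (y' - y) - (z' - z) by abel] at h2 h3
    rw [inner_sub_right] at h2
    rw [inner_neg_left]
    linarith

end Prox

/-! ### Conjugates of prox-functions. -/

section Conj

variable {E : Type*} [NormedAddCommGroup E] [InnerProductSpace ℝ E] [CompleteSpace E]
  {φ : E → ℝ} {dφ : E → E} {σ : ℝ}

/-- Equality in Fenchel–Young: by the Bregman bound, u maximizes ⟨·, dφ u⟩ - φ. -/
lemma IsProxFunction.conj_grad (hφ : IsProxFunction φ dφ σ) (u : E) :
    conj (fun u => (φ u : EReal)) (dφ u) = ((inner ℝ u (dφ u) - φ u : ℝ) : EReal) := by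
  refine le_antisymm (iSup_le fun w => ?_) ?_
  · rw [← EReal.coe_sub, EReal.coe_le_coe_iff]
    have h1 := hφ.bregman w u
    have h2 := mul_nonneg hφ.pos.le (hφ.nonneg (w - u))
    rw [inner_sub_right, real_inner_comm, real_inner_comm _ (dφ u)] at h1
    linarith
  · refine le_trans (le_of_eq ?_) (le_iSup _ u)
    norm_cast

variable [ProperSpace E]

/-- The proximal point at 0 of the linear function -⟨v, ·⟩ satisfies dφ z = v. -/
lemma IsProxFunction.surjective_grad (hφ : IsProxFunction φ dφ σ) :
    Function.Surjective dφ := by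
  intro v
  have hk : IsClosedConvexOn (Set.univ : Set E) (fun η => 0 - (0 + inner ℝ v η)) :=
    IsClosedConvexOn.sub_affine ⟨Set.univ_nonempty, convexOn_const 0 convex_univ,
      fun θ hθ => by simpa using isClosed_le continuous_const hθ, ⟨0, 0, by simp⟩⟩ _ _
  obtain ⟨z, -, hz⟩ := hk.exists_isProxPoint hφ 0
  refine ⟨z, ?_⟩
  have h := hz (z + (v - dφ z)) trivial
  rw [zero_sub, hφ.grad_neg, add_sub_cancel_left] at h
  have h0 : inner ℝ (v - dφ z) (v - dφ z) ≤ 0 := by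
    simp only [inner_add_right, inner_neg_left] at h
    rw [inner_sub_left v (dφ z)]
    linarith
  rw [real_inner_self_eq_norm_sq, sq_nonpos_iff, norm_eq_zero] at h0
  exact (sub_eq_zero.1 h0).symm

/-- The conjugate of a prox-function is differentiable, and its gradient inverts that of the
prox-function. -/
lemma IsProxFunction.hasGradientAt_conj (hφ : IsProxFunction φ dφ σ) (u : E) :
    HasGradientAt (fun v => (conj (fun u => (φ u : EReal)) v).toReal) u (dφ u) := by
  rw [hasGradientAt_iff_isLittleO, Asymptotics.isLittleO_iff]
  intro ε hε
  obtain ⟨κ, hκ, hκφ⟩ := hφ.exists_mul_norm_le hε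
  filter_upwards [Metric.ball_mem_nhds (dφ u) (mul_pos hφ.pos hκ)] with v' hv'
  obtain ⟨w, rfl⟩ := hφ.surjective_grad v'
  simp only [hφ.conj_grad, EReal.toReal_coe]
  rw [mem_ball_iff_norm] at hv'
  have h1 := hφ.bregman u w
  have h2 := hφ.bregman w u
  have h3 := mul_nonneg hφ.pos.le (hφ.nonneg (u - w))
  have e1 : inner ℝ w (dφ w) - φ w - (inner ℝ u (dφ u) - φ u) - inner ℝ u (dφ w - dφ u) =
      φ u - φ w - inner ℝ (dφ w) (u - w) := by
    simp only [inner_sub_right, real_inner_comm]; ring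
  have e2 : φ u - φ w - inner ℝ (dφ w) (u - w) =
      φ u + inner ℝ (dφ u) (w - u) - φ w + inner ℝ (dφ w - dφ u) (w - u) := by
    simp only [inner_sub_right, inner_sub_left]; ring
  rw [e1, Real.norm_of_nonneg (by linarith), e2]
  have h4 := real_inner_le_norm (dφ w - dφ u) (w - u)
  -- The error is the Bregman distance from w to u, that is, ⟨dφ w - dφ u, w - u⟩ minus the reverse
  -- distance. For ‖w - u‖ ≥ ε the reverse distance is at least σκ‖w - u‖ and absorbs the inner
  -- product.
  rcases le_total ‖w - u‖ ε with h | h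
  · have h5 : ‖dφ w - dφ u‖ * ‖w - u‖ ≤ ‖dφ w - dφ u‖ * ε := by gcongr
    have h6 := mul_nonneg hφ.pos.le (hφ.nonneg (w - u))
    linarith
  · have h5 := mul_le_mul_of_nonneg_left (hκφ _ h) hφ.pos.le
    have h6 : ‖dφ w - dφ u‖ * ‖w - u‖ ≤ σ * κ * ‖w - u‖ := by gcongr
    have h7 : 0 ≤ ε * ‖dφ w - dφ u‖ := by positivity
    linarith

end Conj

/-! ### A minimax theorem without compactness. -/

section Minimax

/-- A minimax theorem: `x ↦ sup_η H x η` has infimum `β`, and there is exactly one `z` with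
`β ≤ H x z` for all `x`. Uniform concavity in `η` replaces compactness. -/
theorem existsUnique_saddle {X E : Type*} [AddCommGroup X] [Module ℝ X]
    [NormedAddCommGroup E] [InnerProductSpace ℝ E] [CompleteSpace E]
    {φ : E → ℝ} {dφ : E → E} {σ : ℝ} (hφ : IsProxFunction φ dφ σ)
    {D : Set X} {K : Set E} {H : X → E → ℝ} {s : X → E} {β : ℝ}
    (hconv : ∀ η ∈ K, ConvexOn ℝ D (fun x => H x η))
    (hs : ∀ x ∈ D, s x ∈ K)
    (hgrow : ∀ x ∈ D, ∀ η ∈ K, H x η + σ * φ (η - s x) ≤ H x (s x))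
    (hcl : ∀ x ∈ D, ∀ c : ℝ, IsClosed {η | η ∈ K ∧ c ≤ H x η})
    (hβ : ∀ x ∈ D, β ≤ H x (s x)) (hinf : ∀ δ > 0, ∃ x ∈ D, H x (s x) < β + δ) :
    ∃ z ∈ K, (∀ x ∈ D, β ≤ H x z) ∧ ∀ z' ∈ K, (∀ x ∈ D, β ≤ H x z') → z' = z := by
  have hmax : ∀ x ∈ D, ∀ η ∈ K, H x η ≤ H x (s x) := fun x hx η hη => by
    have := mul_nonneg hφ.pos.le (hφ.nonneg (η - s x))
    linarith [hgrow x hx η hη]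
  -- By growth, near-maximizers of H x lie near s x when x is nearly optimal.
  have hclose : ∀ ρ > 0, ∃ δ > 0, ∀ x ∈ D, H x (s x) ≤ β + δ → ∀ η ∈ K, β - δ ≤ H x η →
      ‖η - s x‖ < ρ := by
    intro ρ hρ
    obtain ⟨κ, hκ, hκφ⟩ := hφ.exists_mul_norm_le hρ
    have hσ := hφ.pos
    refine ⟨σ * (κ * ρ) / 3, by positivity, fun x hx h1 η hη h2 => ?_⟩
    by_contra! hlt
    have h3 := mul_le_mul_of_nonneg_left (hκφ _ hlt) hσ.le
    have h4 : σ * (κ * ρ) ≤ σ * (κ * ‖η - s x‖) := by gcongr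
    have h5 : 0 < σ * (κ * ρ) := by positivity
    linarith [hgrow x hx η hη]
  -- Let p be the midpoint of two near-minimizers. Convexity and β ≤ H p (s p) make s p nearly
  -- maximal for both, hence close to both maximizers.
  have hpair : ∀ ρ > 0, ∃ δ > 0, ∀ x₁ ∈ D, ∀ x₂ ∈ D, H x₁ (s x₁) ≤ β + δ →
      H x₂ (s x₂) ≤ β + δ → ‖s x₁ - s x₂‖ < ρ := by
    intro ρ hρ
    obtain ⟨δ, hδ, h⟩ := hclose (ρ / 2) (half_pos hρ)
    refine ⟨δ, hδ, fun x₁ hx₁ x₂ hx₂ h₁ h₂ => ?_⟩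
    have hD : Convex ℝ D := (hconv _ (hs x₁ hx₁)).1
    have h0 : (0 : ℝ) ≤ 1 / 2 := by norm_num
    have hm := hD hx₁ hx₂ h0 h0 (by norm_num)
    set p := (1 / 2 : ℝ) • x₁ + (1 / 2 : ℝ) • x₂
    have hc := (hconv _ (hs p hm)).2 hx₁ hx₂ h0 h0 (by norm_num)
    simp only [smul_eq_mul] at hc
    have hβp : β ≤ H p (s p) := hβ p hm
    have m₁ := hmax x₁ hx₁ _ (hs p hm)
    have m₂ := hmax x₂ hx₂ _ (hs p hm)
    change H p (s p) ≤ _ at hc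
    have n₁ := h x₁ hx₁ h₁ _ (hs p hm) (by linarith)
    have n₂ := h x₂ hx₂ h₂ _ (hs p hm) (by linarith)
    calc ‖s x₁ - s x₂‖ = ‖(s p - s x₂) - (s p - s x₁)‖ := by congr 1; abel
      _ ≤ ‖s p - s x₂‖ + ‖s p - s x₁‖ := norm_sub_le _ _
      _ < ρ := by linarith
  have htend : ∀ ρ > 0, ∃ N : ℕ, ∀ j ≥ N, 1 / ((j : ℝ) + 1) < ρ := fun ρ hρ => by
    obtain ⟨N, hN⟩ := exists_nat_one_div_lt hρ
    refine ⟨N, fun j hj => lt_of_le_of_lt ?_ hN⟩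
    have : (N : ℝ) ≤ j := by exact_mod_cast hj
    gcongr
  choose xs hxs hxβ using fun j : ℕ => hinf (1 / ((j : ℝ) + 1)) Nat.one_div_pos_of_nat
  have hcauchy : CauchySeq fun j => s (xs j) := by
    rw [Metric.cauchySeq_iff']
    intro ρ hρ
    obtain ⟨δ, hδ, h⟩ := hpair ρ hρ
    obtain ⟨N, hN⟩ := htend δ hδ
    refine ⟨N, fun j hj => ?_⟩
    rw [dist_eq_norm]
    exact h _ (hxs j) _ (hxs N) (by linarith [hxβ j, hN j hj]) (by linarith [hxβ N, hN N le_rfl])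
  obtain ⟨z, hz⟩ := cauchySeq_tendsto_of_complete hcauchy
  -- `s` is close to `z` at approximate minimizers
  have hlim : ∀ ρ > 0, ∃ δ > 0, ∀ x ∈ D, H x (s x) ≤ β + δ → ‖s x - z‖ ≤ ρ := by
    intro ρ hρ
    obtain ⟨δ, hδ, h⟩ := hpair ρ hρ
    obtain ⟨N, hN⟩ := htend δ hδ
    refine ⟨δ, hδ, fun x hx hxδ => ?_⟩
    refine le_of_tendsto (((tendsto_const_nhds (x := s x)).sub hz).norm) ?_
    filter_upwards [Filter.eventually_ge_atTop N] with j hj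
    exact (h x hx _ (hxs j) hxδ (by linarith [hxβ j, hN j hj])).le
  have hmem : ∀ x ∈ D, ∀ c < β, z ∈ K ∧ c ≤ H x z := by
    intro x hx c hc
    change z ∈ {z | z ∈ K ∧ c ≤ H x z}
    rw [← (hcl x hx c).closure_eq, Metric.mem_closure_iff]
    intro ρ hρ
    obtain ⟨δ, hδ, h⟩ := hlim (ρ / 2) (half_pos hρ)
    have hG : 0 ≤ H x (s x) - β := by linarith [hβ x hx]
    -- Move a fraction t from a near-minimizer x₁ towards x. The gap t² at x₁ stays of order t after
    -- division by t, so H x (s p) ≥ β - t ≥ c; the bound by δ keeps p nearly optimal, hence s p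
    -- near z.
    obtain ⟨t, ht0, ht1, htc, htδ⟩ : ∃ t : ℝ, 0 < t ∧ t < 1 ∧ t ≤ β - c ∧
        t * (1 + (H x (s x) - β)) ≤ δ := by
      refine ⟨min (1 / 2) (min (β - c) (δ / (1 + (H x (s x) - β)))), ?_, ?_, ?_, ?_⟩
      · have : 0 < β - c := by linarith
        positivity
      · exact (min_le_left _ _).trans_lt (by norm_num)
      · exact (min_le_right _ _).trans (min_le_left _ _)
      · rw [← le_div_iff₀ (by positivity)]
        exact (min_le_right _ _).trans (min_le_right _ _)
    obtain ⟨x₁, hx₁, hx₁β⟩ := hinf (t ^ 2) (by positivity)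
    have hD : Convex ℝ D := (hconv _ (hs x hx)).1
    have h1t : 0 ≤ 1 - t := by linarith
    have hp := hD hx₁ hx h1t ht0.le (by ring)
    have hcp := (hconv _ (hs _ hp)).2 hx₁ hx h1t ht0.le (by ring)
    simp only [smul_eq_mul] at hcp
    set p := (1 - t) • x₁ + t • x
    change H p (s p) ≤ _ at hcp
    have hβp : β ≤ H p (s p) := hβ p hp
    have m₁ := hmax x₁ hx₁ _ (hs p hp)
    have m₂ := hmax x hx _ (hs p hp)
    have m₁' : (1 - t) * H x₁ (s p) ≤ (1 - t) * (β + t ^ 2) :=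
      mul_le_mul_of_nonneg_left (by linarith) h1t
    have m₂' : t * H x (s p) ≤ t * H x (s x) := mul_le_mul_of_nonneg_left m₂ ht0.le
    refine ⟨s p, ⟨hs p hp, ?_⟩, ?_⟩
    · have : t * (β - t) ≤ t * H x (s p) := by nlinarith
      linarith [le_of_mul_le_mul_left this ht0]
    · rw [dist_comm, dist_eq_norm]
      refine (h p hp ?_).trans_lt (by linarith)
      nlinarith
  obtain ⟨x₀, hx₀, -⟩ := hinf 1 one_pos
  have hzK : z ∈ K := (hmem x₀ hx₀ (β - 1) (by linarith)).1
  refine ⟨z, hzK, fun x hx => le_of_forall_lt fun c hc => ?_, fun z' hz' hz'β => ?_⟩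
  · obtain ⟨c', hc', hc'β⟩ := exists_between hc
    exact hc'.trans_le (hmem x hx c' hc'β).2
  · rw [← sub_eq_zero, ← norm_le_zero_iff]
    refine le_of_forall_pos_le_add fun ρ hρ => ?_
    obtain ⟨δ₁, hδ₁, h₁⟩ := hlim (ρ / 2) (half_pos hρ)
    obtain ⟨δ₂, hδ₂, h₂⟩ := hclose (ρ / 2) (half_pos hρ)
    obtain ⟨x, hx, hxδ⟩ := hinf (min δ₁ δ₂) (lt_min hδ₁ hδ₂)
    have n₁ := h₁ x hx (by linarith [min_le_left δ₁ δ₂])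
    have n₂ := h₂ x hx (by linarith [min_le_right δ₁ δ₂]) z' hz' (by linarith [hz'β x hx])
    calc ‖z' - z‖ = ‖(z' - s x) + (s x - z)‖ := by congr 1; abel
      _ ≤ ‖z' - s x‖ + ‖s x - z‖ := norm_add_le _ _
      _ ≤ 0 + ρ := by linarith

end Minimax

/-! ### The conjugate of a function in Γ₀. -/

section ConjGammaZero

variable {E : Type*} [NormedAddCommGroup E] [InnerProductSpace ℝ E] {g : E → EReal}

lemma coe_toReal_of_mem_dom {X : Type*} {h : X → EReal} {x : X} (hx : x ∈ dom h)
    (hbot : h x ≠ ⊥) : ((h x).toReal : EReal) = h x :=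
  EReal.coe_toReal (ne_of_lt hx) hbot

lemma conj_le_coe_iff (hbot : ∀ u, g u ≠ ⊥) {v : E} {c : ℝ} :
    conj g v ≤ (c : EReal) ↔ ∀ u ∈ dom g, inner ℝ u v - (g u).toReal ≤ c := by
  rw [conj, iSup_le_iff]
  refine forall_congr' fun u => ?_
  by_cases hu : u ∈ dom g
  · rw [← coe_toReal_of_mem_dom hu (hbot u), ← EReal.coe_sub, EReal.coe_le_coe_iff]
    simp [hu]
  · have : g u = ⊤ := not_lt_top_iff.1 hu
    simp [hu, this]

lemma conj_ne_bot (hbot : ∀ u, g u ≠ ⊥) (hdom : (dom g).Nonempty) (v : E) : conj g v ≠ ⊥ := by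
  obtain ⟨u, hu⟩ := hdom
  intro h
  have := (conj_le_coe_iff hbot (v := v) (c := inner ℝ u v - (g u).toReal - 1)).1
    (h ▸ bot_le) u hu
  linarith

lemma toReal_conj_le_iff (hbot : ∀ u, g u ≠ ⊥) (hdom : (dom g).Nonempty) {v : E}
    (hv : v ∈ dom (conj g)) {c : ℝ} :
    (conj g v).toReal ≤ c ↔ ∀ u ∈ dom g, inner ℝ u v - (g u).toReal ≤ c := by
  rw [← conj_le_coe_iff hbot, ← EReal.coe_le_coe_iff,
    coe_toReal_of_mem_dom hv (conj_ne_bot hbot hdom v)]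

variable [CompleteSpace E]

/-- A function in `Γ₀(E)` has an affine minorant. -/
lemma IsGammaZero.nonempty_dom_conj (hg : IsGammaZero g) : (dom (conj g)).Nonempty := by
  obtain ⟨u₀, hu₀⟩ := hg.proper
  have hepi : ∀ u ∈ dom g, (u, (g u).toReal) ∈ {z : E × ℝ | g z.1 ≤ (z.2 : EReal)} :=
    fun u hu => (coe_toReal_of_mem_dom hu (hg.ne_bot u)).ge
  have hcl : IsClosed {z : E × ℝ | g z.1 ≤ (z.2 : EReal)} :=
    (lowerSemicontinuous_iff_isClosed_epigraph.1 hg.lsc).preimage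
      (f := fun z : E × ℝ => (z.1, (z.2 : EReal)))
      (continuous_fst.prodMk (continuous_coe_real_ereal.comp continuous_snd))
  have hnot : (u₀, (g u₀).toReal - 1) ∉ {z : E × ℝ | g z.1 ≤ (z.2 : EReal)} := fun h => by
    change g u₀ ≤ (((g u₀).toReal - 1 : ℝ) : EReal) at h
    rw [← coe_toReal_of_mem_dom hu₀ (hg.ne_bot u₀), EReal.coe_le_coe_iff, EReal.toReal_coe] at h
    linarith
  obtain ⟨F, μ, hF₀, hF⟩ := geometric_hahn_banach_point_closed hg.convex hcl hnot
  have hsplit : ∀ (u : E) (t : ℝ), F (u, t) = F (u, 0) + t * F (0, 1) := fun u t => by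
    rw [← smul_eq_mul, ← map_smul, ← map_add]
    simp
  -- The separated points share the abscissa u₀, so the hyperplane is not vertical.
  have hτ : 0 < F (0, 1) := by
    have h1 := hF _ (hepi u₀ hu₀)
    rw [hsplit] at hF₀ h1
    linarith
  set τ := F (0, 1)
  let ℓ : E →L[ℝ] ℝ := F.comp (ContinuousLinearMap.inl ℝ E ℝ)
  refine ⟨-(τ⁻¹ • (InnerProductSpace.toDual ℝ E).symm ℓ), ?_⟩
  refine lt_of_le_of_lt ((conj_le_coe_iff hg.ne_bot (c := -(μ / τ))).2 fun u hu => ?_)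
    (EReal.coe_lt_top _)
  have h1 := hF _ (hepi u hu)
  have h2 : ℓ u = F (u, 0) := rfl
  rw [hsplit, ← h2] at h1
  rw [inner_neg_right, real_inner_smul_right, real_inner_comm,
    InnerProductSpace.toDual_symm_apply, neg_sub_left, neg_le_neg_iff, div_le_iff₀ hτ]
  field_simp
  linarith

/-- As a supremum of affine functions indexed by `dom g`, g* inherits convexity, closedness and a
minorant from them. -/
lemma IsGammaZero.isClosedConvexOn_conj (hg : IsGammaZero g) :
    IsClosedConvexOn (dom (conj g)) (fun η => (conj g η).toReal) := by
  have hle := @toReal_conj_le_iff _ _ _ g hg.ne_bot hg.proper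
  have hsub : ∀ η ∈ dom (conj g), ∀ u ∈ dom g,
      inner ℝ u η - (g u).toReal ≤ (conj g η).toReal := fun η hη => (hle hη).1 le_rfl
  have hcomb : ∀ x ∈ dom (conj g), ∀ y ∈ dom (conj g), ∀ a b : ℝ, 0 ≤ a → 0 ≤ b → a + b = 1 →
      ∀ u ∈ dom g, inner ℝ u (a • x + b • y) - (g u).toReal ≤
        a * (conj g x).toReal + b * (conj g y).toReal := by
    intro x hx y hy a b ha hb hab u hu
    have h1 := mul_le_mul_of_nonneg_left (hsub x hx u hu) ha
    have h2 := mul_le_mul_of_nonneg_left (hsub y hy u hu) hb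
    rw [inner_add_right, real_inner_smul_right, real_inner_smul_right]
    linear_combination h1 + h2 + (g u).toReal * hab
  have hconv : Convex ℝ (dom (conj g)) := fun x hx y hy a b ha hb hab =>
    lt_of_le_of_lt ((conj_le_coe_iff hg.ne_bot).2 (hcomb x hx y hy a b ha hb hab))
      (EReal.coe_lt_top _)
  refine ⟨hg.nonempty_dom_conj, ⟨hconv, fun x hx y hy a b ha hb hab => ?_⟩, fun θ hθ => ?_, ?_⟩
  · exact (hle (hconv hx hy ha hb hab)).2 (hcomb x hx y hy a b ha hb hab)
  · have : {η | η ∈ dom (conj g) ∧ (conj g η).toReal ≤ θ η} =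
        ⋂ u ∈ dom g, {η | inner ℝ u η - (g u).toReal ≤ θ η} := by
      ext η
      simp only [Set.mem_iInter]
      refine ⟨fun h => (hle h.1).1 h.2, fun h => ?_⟩
      have hη : η ∈ dom (conj g) :=
        lt_of_le_of_lt ((conj_le_coe_iff hg.ne_bot).2 h) (EReal.coe_lt_top _)
      exact ⟨hη, (hle hη).2 h⟩
    rw [this]
    exact isClosed_biInter fun u _ => isClosed_le (by fun_prop) hθ
  · obtain ⟨u, hu⟩ := hg.proper
    exact ⟨u, -(g u).toReal, fun η hη => by linarith [hsub η hη u hu]⟩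

end ConjGammaZero

/-! ### The augmented Lagrangian and its dual update. -/

section Lagrangian

variable {n m : ℕ} {f : EuclideanSpace ℝ (Fin n) → EReal} {g : EuclideanSpace ℝ (Fin m) → EReal}
  {A : EuclideanSpace ℝ (Fin n) → EuclideanSpace ℝ (Fin m)} {x : EuclideanSpace ℝ (Fin n)}
  {y z η : EuclideanSpace ℝ (Fin m)} {p r lam : ℝ}

variable (f g A) in
/-- The real-valued negative Lagrangian, meaningful on `dom f × dom g*`. -/
noncomputable def negLagr (x : EuclideanSpace ℝ (Fin n)) (η : EuclideanSpace ℝ (Fin m)) : ℝ :=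
  (conj g η).toReal - ((f x).toReal + inner ℝ (A x) η)

lemma IsGammaZero.isClosedConvexOn_negLagr (hg : IsGammaZero g) (x : EuclideanSpace ℝ (Fin n)) :
    IsClosedConvexOn (dom (conj g)) (negLagr f g A x) :=
  hg.isClosedConvexOn_conj.sub_affine _ _

lemma lagr_of_notMem (hx : x ∉ dom f) (η : EuclideanSpace ℝ (Fin m)) :
    lagr f g A x η = ⊤ := if_pos (not_lt_top_iff.1 hx)

lemma lagr_of_mem (hf : IsGammaZero f) (hg : IsGammaZero g) (hx : x ∈ dom f)
    (hη : η ∈ dom (conj g)) : lagr f g A x η = ((-negLagr f g A x η : ℝ) : EReal) := by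
  rw [lagr, if_neg (ne_of_lt hx), negLagr, neg_sub, EReal.coe_sub, EReal.coe_add,
    coe_toReal_of_mem_dom hx (hf.ne_bot x),
    coe_toReal_of_mem_dom hη (conj_ne_bot hg.ne_bot hg.proper η)]

lemma lagr_of_mem_of_notMem (hx : x ∈ dom f) (hη : η ∉ dom (conj g)) :
    lagr f g A x η = ⊥ := by
  have h : conj g η = ⊤ := not_lt_top_iff.1 hη
  rw [lagr, if_neg (ne_of_lt hx), h, EReal.sub_top]

/-- Convexity of `dom f` also comes from `hL`, because L(·, η) is +∞ exactly off `dom f` when η ∈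
dom g*. -/
lemma convexOn_lagr (hf : IsGammaZero f) (hg : IsGammaZero g)
    (hL : ∀ y, ConvexFun (fun x => lagr f g A x y)) (hη : η ∈ dom (conj g)) :
    ConvexOn ℝ (dom f) (fun x => -negLagr f g A x η) := by
  have hmem : ∀ x ∈ dom f, (x, -negLagr f g A x η) ∈
      {z : EuclideanSpace ℝ (Fin n) × ℝ | lagr f g A z.1 η ≤ (z.2 : EReal)} :=
    fun x hx => (lagr_of_mem hf hg hx hη).le
  have hcomb := fun x (hx : x ∈ dom f) x' (hx' : x' ∈ dom f) (a b : ℝ) ha hb hab =>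
    (hL η) (hmem x hx) (hmem x' hx') (a := a) (b := b) ha hb hab
  have hconv : Convex ℝ (dom f) := fun x hx x' hx' a b ha hb hab => by
    by_contra hnot
    have h : lagr f g A (a • x + b • x') η ≤ _ := hcomb x hx x' hx' a b ha hb hab
    rw [lagr_of_notMem hnot, top_le_iff] at h
    exact EReal.coe_ne_top _ h
  refine ⟨hconv, fun x hx x' hx' a b ha hb hab => ?_⟩
  have h : lagr f g A (a • x + b • x') η ≤ _ := hcomb x hx x' hx' a b ha hb hab
  rw [lagr_of_mem hf hg (hconv hx hx' ha hb hab) hη, EReal.coe_le_coe_iff] at h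
  exact h

lemma negDual_le_coe_iff (hf : IsGammaZero f) (hg : IsGammaZero g) {c : ℝ} :
    negDual f g A η ≤ (c : EReal) ↔
      η ∈ dom (conj g) ∧ ∀ x ∈ dom f, negLagr f g A x η ≤ c := by
  rw [negDual, dualFun, EReal.neg_le, ← EReal.coe_neg, le_iInf_iff]
  constructor
  · intro h
    have hη : η ∈ dom (conj g) := by
      by_contra hnot
      obtain ⟨x, hx⟩ := hf.proper
      have := h x
      rw [lagr_of_mem_of_notMem hx hnot, le_bot_iff] at this
      exact EReal.coe_ne_bot _ this
    refine ⟨hη, fun x hx => ?_⟩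
    have := h x
    rw [lagr_of_mem hf hg hx hη, EReal.coe_le_coe_iff] at this
    linarith
  · rintro ⟨hη, h⟩ x
    by_cases hx : x ∈ dom f
    · rw [lagr_of_mem hf hg hx hη, EReal.coe_le_coe_iff]
      linarith [h x hx]
    · rw [lagr_of_notMem hx]
      exact le_top

lemma augLagr_of_notMem (hx : x ∉ dom f) : augLagr f g A p r lam x y = ⊤ := by
  rw [augLagr, eq_top_iff]
  refine le_trans ?_ (le_iSup _ 0)
  rw [lagr_of_notMem hx, EReal.top_sub_coe]

lemma isProxFunction_epiPhi (hp : 1 ≤ p) (hr : r = 2 ∨ r = p + 1) (hlam : 0 < lam) :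
    IsProxFunction (epiPhi p r lam : EuclideanSpace ℝ (Fin m) → ℝ)
      (fun u => gradPhi p r (lam⁻¹ • u)) (2 ^ (1 - p)) :=
  (isProxFunction_phi hp hr).epiScale hlam

variable (f g A p r lam) in
/-- `z` is the dual update at `(x, y)`: the maximizer of `L(x, ·) - (lam ⋆ φ)(y - ·)`. -/
def IsDualUpdate (x : EuclideanSpace ℝ (Fin n)) (y z : EuclideanSpace ℝ (Fin m)) : Prop :=
  IsProxPoint (dom (conj g)) (negLagr f g A x) (fun u => gradPhi p r (lam⁻¹ • u)) y z

lemma IsDualUpdate.augLagr_eq (hf : IsGammaZero f) (hg : IsGammaZero g) (hp : 1 ≤ p)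
    (hr : r = 2 ∨ r = p + 1) (hlam : 0 < lam) (hx : x ∈ dom f)
    (hz : IsDualUpdate f g A p r lam x y z) :
    augLagr f g A p r lam x y =
      ((-(negLagr f g A x z + epiPhi p r lam (y - z)) : ℝ) : EReal) := by
  have hω := isProxFunction_epiPhi (m := m) hp hr hlam
  refine le_antisymm (iSup_le fun η => ?_) (le_trans (le_of_eq ?_) (le_iSup _ z))
  · by_cases hη : η ∈ dom (conj g)
    · rw [lagr_of_mem hf hg hx hη, ← EReal.coe_sub, EReal.coe_le_coe_iff]
      have := hz.growth hω hη
      have := mul_nonneg hω.pos.le (hω.nonneg (η - z))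
      linarith
    · rw [lagr_of_mem_of_notMem hx hη, EReal.bot_sub]
      exact bot_le
  · rw [lagr_of_mem hf hg hx hz.1, ← EReal.coe_sub]
    congr 1
    ring

lemma exists_isDualUpdate (hg : IsGammaZero g) (hp : 1 ≤ p) (hr : r = 2 ∨ r = p + 1)
    (hlam : 0 < lam) (x : EuclideanSpace ℝ (Fin n)) (y : EuclideanSpace ℝ (Fin m)) :
    ∃ z, IsDualUpdate f g A p r lam x y z :=
  (hg.isClosedConvexOn_negLagr x).exists_isProxPoint (isProxFunction_epiPhi hp hr hlam) y

lemma IsDualUpdate.hasGradientAt (hf : IsGammaZero f) (hg : IsGammaZero g) (hp : 1 ≤ p)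
    (hr : r = 2 ∨ r = p + 1) (hlam : 0 < lam) (hx : x ∈ dom f)
    (hz : IsDualUpdate f g A p r lam x y z) :
    HasGradientAt (fun y => (augLagr f g A p r lam x y).toReal)
      (-gradPhi p r (lam⁻¹ • (y - z))) y := by
  refine IsProxPoint.hasGradientAt (isProxFunction_epiPhi hp hr hlam) (fun y' => ?_) hz
  obtain ⟨z', hz'⟩ := exists_isDualUpdate (f := f) (A := A) hg hp hr hlam x y'
  exact ⟨z', hz', by rw [hz'.augLagr_eq hf hg hp hr hlam hx, EReal.toReal_coe]⟩

lemma IsDualUpdate.gradAugLagr_eq (hf : IsGammaZero f) (hg : IsGammaZero g) (hp : 1 ≤ p)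
    (hr : r = 2 ∨ r = p + 1) (hlam : 0 < lam) (hx : x ∈ dom f)
    (hz : IsDualUpdate f g A p r lam x y z) :
    gradAugLagr f g A p r lam x y = -gradPhi p r (lam⁻¹ • (y - z)) :=
  (hz.hasGradientAt hf hg hp hr hlam hx).gradient

/-- Oddness of ∇φ and inversion by ∇φ* turn the step into lam · (-lam⁻¹(y - z)) = z - y. -/
lemma IsDualUpdate.dualUpdate_eq (hf : IsGammaZero f) (hg : IsGammaZero g) (hp : 1 ≤ p)
    (hr : r = 2 ∨ r = p + 1) (hlam : 0 < lam) (hx : x ∈ dom f)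
    (hz : IsDualUpdate f g A p r lam x y z) : dualUpdate f g A p r lam x y = z := by
  have hφ := isProxFunction_phi (m := m) hp hr
  rw [dualUpdate, hz.gradAugLagr_eq hf hg hp hr hlam hx, ← hφ.grad_neg]
  have h : gradient (fun v => (phiConj p r v).toReal) (gradPhi p r (-(lam⁻¹ • (y - z)))) =
    -(lam⁻¹ • (y - z)) := (hφ.hasGradientAt_conj _).gradient
  rw [h, smul_neg, smul_inv_smul₀ hlam.ne']
  abel

lemma isDualUpdate_dualUpdate (hf : IsGammaZero f) (hg : IsGammaZero g) (hp : 1 ≤ p)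
    (hr : r = 2 ∨ r = p + 1) (hlam : 0 < lam) (hx : x ∈ dom f)
    (y : EuclideanSpace ℝ (Fin m)) :
    IsDualUpdate f g A p r lam x y (dualUpdate f g A p r lam x y) := by
  obtain ⟨z, hz⟩ := exists_isDualUpdate (f := f) (A := A) hg hp hr hlam x y
  rwa [hz.dualUpdate_eq hf hg hp hr hlam hx]

/-- An approximate minimizer of a function with nonempty domain lies in the domain. -/
lemma mem_dom_of_le_iInf_add {X : Type*} {h : X → EReal} (hdom : (dom h).Nonempty) {x : X}
    {ε : ℝ} (hx : h x ≤ (⨅ x, h x) + (ε : EReal)) : x ∈ dom h := by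
  obtain ⟨x₀, hx₀⟩ := hdom
  exact hx.trans_lt (EReal.add_lt_top (ne_of_lt ((iInf_le _ x₀).trans_lt hx₀))
    (EReal.coe_ne_top ε))

lemma le_iInf_add_coe_iff {X : Type*} {h : X → EReal} {a ε : ℝ} :
    (a : EReal) ≤ (⨅ x, h x) + (ε : EReal) ↔ ∀ x, ((a - ε : ℝ) : EReal) ≤ h x := by
  rw [← le_iInf_iff, EReal.coe_sub,
    EReal.sub_le_iff_le_add (Or.inl (EReal.coe_ne_bot _)) (Or.inl (EReal.coe_ne_top _))]

end Lagrangian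

/-! ### The three inexactness statements. -/

section InexactUpdates

variable {n m : ℕ} {f : EuclideanSpace ℝ (Fin n) → EReal} {g : EuclideanSpace ℝ (Fin m) → EReal}
  {A : EuclideanSpace ℝ (Fin n) → EuclideanSpace ℝ (Fin m)} {x : EuclideanSpace ℝ (Fin n)}
  {y z η : EuclideanSpace ℝ (Fin m)} {p r lam ε : ℝ}

lemma IsGammaZero.dom_lagr_nonempty (hf : IsGammaZero f) (hg : IsGammaZero g)
    (η : EuclideanSpace ℝ (Fin m)) : (dom fun x => lagr f g A x η).Nonempty := by
  obtain ⟨x, hx⟩ := hf.proper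
  refine ⟨x, ?_⟩
  change lagr f g A x η < ⊤
  by_cases hη : η ∈ dom (conj g)
  · rw [lagr_of_mem hf hg hx hη]
    exact EReal.coe_lt_top _
  · rw [lagr_of_mem_of_notMem hx hη]
    exact bot_lt_top

lemma mem_dom_of_lagr_lt_top (h : x ∈ dom fun x => lagr f g A x η) : x ∈ dom f := by
  by_contra hx
  exact ne_of_lt h (lagr_of_notMem hx η)

lemma mem_dom_of_augLagr_lt_top (h : x ∈ dom fun x => augLagr f g A p r lam x y) :
    x ∈ dom f := by
  by_contra hx
  exact ne_of_lt h (augLagr_of_notMem hx)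

lemma dom_augLagr_nonempty (hf : IsGammaZero f) (hg : IsGammaZero g) (hp : 1 ≤ p)
    (hr : r = 2 ∨ r = p + 1) (hlam : 0 < lam) (y : EuclideanSpace ℝ (Fin m)) :
    (dom fun x => augLagr f g A p r lam x y).Nonempty := by
  obtain ⟨x, hx⟩ := hf.proper
  refine ⟨x, ?_⟩
  change augLagr f g A p r lam x y < ⊤
  rw [(isDualUpdate_dualUpdate hf hg hp hr hlam hx y).augLagr_eq hf hg hp hr hlam hx]
  exact EReal.coe_lt_top _

lemma IsDualUpdate.mem_epsSubdiff (hf : IsGammaZero f) (hg : IsGammaZero g) (hp : 1 ≤ p)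
    (hr : r = 2 ∨ r = p + 1) (hlam : 0 < lam) (hx : x ∈ dom f)
    (hz : IsDualUpdate f g A p r lam x y z)
    (hmin : lagr f g A x z ≤ (⨅ x, lagr f g A x z) + (ε : EReal)) :
    -gradAugLagr f g A p r lam x y ∈ epsSubdiff ε (negDual f g A) z := by
  rw [lagr_of_mem hf hg hx hz.1, le_iInf_add_coe_iff] at hmin
  have hle : negDual f g A z ≤ ((negLagr f g A x z + ε : ℝ) : EReal) := by
    refine (negDual_le_coe_iff hf hg).2 ⟨hz.1, fun x' hx' => ?_⟩
    have := hmin x'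
    rw [lagr_of_mem hf hg hx' hz.1, EReal.coe_le_coe_iff] at this
    linarith
  refine ⟨ne_top_of_le_ne_top (EReal.coe_ne_top _) hle, fun hbot => ?_, fun η => ?_⟩
  · have := ((negDual_le_coe_iff hf hg (c := negLagr f g A x z - 1)).1
      (hbot ▸ bot_le)).2 x hx
    linarith
  · refine EReal.le_of_forall_lt_iff_le.1 fun c hc => ?_
    obtain ⟨hη, h⟩ := (negDual_le_coe_iff hf hg).1 hc.le
    refine (add_le_add_left hle _).trans ?_
    rw [← EReal.coe_add, EReal.coe_le_coe_iff, hz.gradAugLagr_eq hf hg hp hr hlam hx, neg_neg]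
    have := hz.2 η hη
    linarith [h x hx]

/-- The saddle point theorem for the augmented Lagrangian, tilted by a linear functional. -/
lemma existsUnique_saddle_augLagr (hf : IsGammaZero f) (hg : IsGammaZero g)
    (hL : ∀ y, ConvexFun (fun x => lagr f g A x y)) (hp : 1 ≤ p) (hr : r = 2 ∨ r = p + 1)
    (hlam : 0 < lam) (y : EuclideanSpace ℝ (Fin m)) (e : EuclideanSpace ℝ (Fin n))
    {s : EuclideanSpace ℝ (Fin n) → EuclideanSpace ℝ (Fin m)}
    (hs : ∀ x ∈ dom f, IsDualUpdate f g A p r lam x y (s x)) {β : ℝ}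
    (hβ : ∀ x ∈ dom f, negLagr f g A x (s x) + epiPhi p r lam (y - s x) + inner ℝ e x ≤ -β)
    (hinf : ∀ δ > 0, ∃ x ∈ dom f,
      -β - δ < negLagr f g A x (s x) + epiPhi p r lam (y - s x) + inner ℝ e x) :
    ∃ z ∈ dom (conj g),
      (∀ x ∈ dom f, negLagr f g A x z + epiPhi p r lam (y - z) + inner ℝ e x ≤ -β) ∧
      ∀ z' ∈ dom (conj g),
        (∀ x ∈ dom f, negLagr f g A x z' + epiPhi p r lam (y - z') + inner ℝ e x ≤ -β) →
          z' = z := by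
  have hω := isProxFunction_epiPhi (m := m) hp hr hlam
  have key := existsUnique_saddle hω (D := dom f) (K := dom (conj g)) (s := s) (β := β)
    (H := fun x η => -(negLagr f g A x η + epiPhi p r lam (y - η) + inner ℝ e x))
    (fun η hη => ?_) (fun x hx => (hs x hx).1) (fun x hx η hη => ?_) (fun x hx c => ?_)
    (fun x hx => ?_) (fun δ hδ => ?_)
  · simpa only [le_neg (a := β)] using key
  · have h := convexOn_lagr hf hg hL hη
    refine ⟨h.1, fun x hx x' hx' a b ha hb hab => ?_⟩
    have := h.2 hx hx' ha hb hab
    simp only [smul_eq_mul, inner_add_right, real_inner_smul_right] at this ⊢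
    linear_combination this + epiPhi p r lam (y - η) * hab
  · have := (hs x hx).growth hω hη
    linarith
  · have hc := hω.continuous
    convert (hg.isClosedConvexOn_negLagr (f := f) (A := A) x).isClosed
      (fun η => -c - epiPhi p r lam (y - η) - inner ℝ e x) (by fun_prop) using 3 with η
    exact and_congr_right fun _ => ⟨fun h => by linarith, fun h => by linarith⟩
  · linarith [hβ x hx]
  · obtain ⟨x, hx, h⟩ := hinf δ hδ
    exact ⟨x, hx, by linarith⟩

lemma isEpsProximalPoint_dualUpdate (hf : IsGammaZero f) (hg : IsGammaZero g)
    (hL : ∀ y, ConvexFun (fun x => lagr f g A x y)) (hp : 1 ≤ p) (hr : r = 2 ∨ r = p + 1)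
    (hlam : 0 < lam) (hx : x ∈ dom f)
    (hmin : augLagr f g A p r lam x y ≤ (⨅ x, augLagr f g A p r lam x y) + (ε : EReal)) :
    IsEpsProximalPoint p r lam ((2 : ℝ) ^ (p - 1) * ε) (negDual f g A) y
      (dualUpdate f g A p r lam x y) := by
  have hω := isProxFunction_epiPhi (m := m) hp hr hlam
  have hs : ∀ x ∈ dom f, IsDualUpdate f g A p r lam x y (dualUpdate f g A p r lam x y) :=
    fun x hx => isDualUpdate_dualUpdate hf hg hp hr hlam hx y
  have haug := fun x hx => (hs x hx).augLagr_eq hf hg hp hr hlam hx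
  set s := fun x => dualUpdate f g A p r lam x y
  change ∀ x ∈ dom f, IsDualUpdate f g A p r lam x y (s x) at hs
  change ∀ x ∈ dom f, augLagr f g A p r lam x y =
    ((-(negLagr f g A x (s x) + epiPhi p r lam (y - s x)) : ℝ) : EReal) at haug
  have hmin' := hmin
  rw [haug x hx, le_iInf_add_coe_iff, ← le_iInf_iff] at hmin'
  obtain ⟨β, hβ⟩ : ∃ β : ℝ, (β : EReal) = ⨅ x, augLagr f g A p r lam x y :=
    ⟨_, EReal.coe_toReal
      (ne_top_of_le_ne_top (haug x hx ▸ EReal.coe_ne_top _) (iInf_le _ x))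
      (ne_bot_of_le_ne_bot (EReal.coe_ne_bot _) hmin')⟩
  have hlow : ∀ x ∈ dom f, negLagr f g A x (s x) + epiPhi p r lam (y - s x) ≤ -β := by
    intro x' hx'
    have h := hβ.le.trans (iInf_le _ x')
    rw [haug x' hx', EReal.coe_le_coe_iff] at h
    linarith
  have hinf : ∀ δ > 0, ∃ x ∈ dom f,
      -β - δ < negLagr f g A x (s x) + epiPhi p r lam (y - s x) := by
    intro δ hδ
    have : ⨅ x, augLagr f g A p r lam x y < ((β + δ : ℝ) : EReal) := by
      rw [← hβ, EReal.coe_lt_coe_iff]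
      linarith
    obtain ⟨x', hx'⟩ := iInf_lt_iff.1 this
    have hx'D : x' ∈ dom f := mem_dom_of_augLagr_lt_top (hx'.trans (EReal.coe_lt_top _))
    rw [haug x' hx'D, EReal.coe_lt_coe_iff] at hx'
    exact ⟨x', hx'D, by linarith⟩
  obtain ⟨z, hzK, hz, huniq⟩ := existsUnique_saddle_augLagr hf hg hL hp hr hlam y 0 hs (β := β)
    (by simpa using hlow) (by simpa using hinf)
  simp only [inner_zero_left, add_zero] at hz huniq
  have hval : ∀ η, ∀ c : ℝ, negDual f g A η + (epiPhi p r lam (y - η) : EReal) ≤ (c : EReal) ↔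
      η ∈ dom (conj g) ∧ ∀ x ∈ dom f, negLagr f g A x η + epiPhi p r lam (y - η) ≤ c := by
    intro η c
    rw [← EReal.le_sub_iff_add_le (Or.inl (EReal.coe_ne_bot _)) (Or.inl (EReal.coe_ne_top _)),
      ← EReal.coe_sub, negDual_le_coe_iff hf hg]
    simp only [le_sub_iff_add_le]
  have hzval : negDual f g A z + (epiPhi p r lam (y - z) : EReal) ≤ ((-β : ℝ) : EReal) :=
    (hval z _).2 ⟨hzK, hz⟩
  refine ⟨z, ?_, ?_⟩
  · refine Set.eq_singleton_iff_unique_mem.2 ⟨fun η => hzval.trans ?_, fun z' hz' => ?_⟩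
    · refine EReal.le_of_forall_lt_iff_le.1 fun c hc => ?_
      obtain ⟨hη, h⟩ := (hval η c).1 hc.le
      rw [EReal.coe_le_coe_iff]
      by_contra! hlt
      obtain ⟨x', hx', h'⟩ := hinf (-β - c) (by linarith)
      have h1 := (hs x' hx').growth hω hη
      have h2 := h x' hx'
      have h3 := mul_nonneg hω.pos.le (hω.nonneg (η - s x'))
      linarith
    · obtain ⟨hz'K, h⟩ := (hval z' (-β)).1 ((hz' z).trans hzval)
      exact huniq z' hz'K h
  -- Growth at x compares its maximizer s x with the saddle point z.
  · have h1 := (hs x hx).growth hω hzK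
    have h2 := hz x hx
    have h3 := hβ ▸ hmin'
    rw [EReal.coe_le_coe_iff] at h3
    rw [← neg_sub (s x) z, hω.even] at h1
    have h4 : (2 : ℝ) ^ (1 - p) * epiPhi p r lam (s x - z) ≤ ε := by linarith
    have h5 : (2 : ℝ) ^ (p - 1) * 2 ^ (1 - p) = 1 := by
      rw [← Real.rpow_add two_pos]
      simp
    calc epiPhi p r lam (s x - z)
        = 2 ^ (p - 1) * (2 ^ (1 - p) * epiPhi p r lam (s x - z)) := by
          rw [← mul_assoc, h5, one_mul]
      _ ≤ 2 ^ (p - 1) * ε := by gcongr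

/-- A Danskin-type transfer of e from L_lam(·, y) to L(·, s x). After tilting by e, the infimum is
attained at x, so the saddle point must be s x. -/
lemma inner_le_lagr_sub (hf : IsGammaZero f) (hg : IsGammaZero g)
    (hL : ∀ y, ConvexFun (fun x => lagr f g A x y)) (hp : 1 ≤ p) (hr : r = 2 ∨ r = p + 1)
    (hlam : 0 < lam) {s : EuclideanSpace ℝ (Fin n) → EuclideanSpace ℝ (Fin m)}
    (hs : ∀ x ∈ dom f, IsDualUpdate f g A p r lam x y (s x)) (hx : x ∈ dom f)
    {e : EuclideanSpace ℝ (Fin n)}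
    (he : ∀ x' ∈ dom f, negLagr f g A x' (s x') + epiPhi p r lam (y - s x') + inner ℝ e (x' - x) ≤
      negLagr f g A x (s x) + epiPhi p r lam (y - s x)) :
    ∀ x' ∈ dom f, negLagr f g A x' (s x) + inner ℝ e (x' - x) ≤ negLagr f g A x (s x) := by
  have hω := isProxFunction_epiPhi (m := m) hp hr hlam
  simp only [inner_sub_right] at he ⊢
  obtain ⟨z, hzK, hz, -⟩ := existsUnique_saddle_augLagr hf hg hL hp hr hlam y e hs
    (β := -(negLagr f g A x (s x) + epiPhi p r lam (y - s x) + inner ℝ e x))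
    (fun x' hx' => by linarith [he x' hx']) (fun δ hδ => ⟨x, hx, by linarith⟩)
  have hzs : z = s x := by
    have h1 := (hs x hx).growth hω hzK
    have h2 := hz x hx
    have h3 : (2 : ℝ) ^ (1 - p) * epiPhi p r lam (z - s x) ≤ 0 := by linarith
    exact sub_eq_zero.1 (hω.eq_of_le_zero (nonpos_of_mul_nonpos_right h3 hω.pos))
  intro x' hx'
  have := hz x' hx'
  rw [hzs] at this
  linarith

lemma approx_min_of_mem_subdiff (hf : IsGammaZero f) (hg : IsGammaZero g)
    (hL : ∀ y, ConvexFun (fun x => lagr f g A x y)) (hp : 1 ≤ p) (hr : r = 2 ∨ r = p + 1)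
    (hlam : 0 < lam) (hbd : Bornology.IsBounded (dom f)) {e : EuclideanSpace ℝ (Fin n)}
    (he : e ∈ subdiff (fun x => augLagr f g A p r lam x y) x)
    (heε : ‖e‖ * Metric.diam (dom f) ≤ ε) :
    lagr f g A x (dualUpdate f g A p r lam x y) ≤
        (⨅ x', lagr f g A x' (dualUpdate f g A p r lam x y)) + (ε : EReal) ∧
      augLagr f g A p r lam x y ≤ (⨅ x', augLagr f g A p r lam x' y) + (ε : EReal) := by
  have hx : x ∈ dom f := mem_dom_of_augLagr_lt_top (lt_top_iff_ne_top.2 he.1)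
  have hs : ∀ x ∈ dom f, IsDualUpdate f g A p r lam x y (dualUpdate f g A p r lam x y) :=
    fun x hx => isDualUpdate_dualUpdate hf hg hp hr hlam hx y
  have haug := fun x hx => (hs x hx).augLagr_eq hf hg hp hr hlam hx
  have hsub : ∀ x' ∈ dom f, negLagr f g A x' (dualUpdate f g A p r lam x' y) +
      epiPhi p r lam (y - dualUpdate f g A p r lam x' y) + inner ℝ e (x' - x) ≤
        negLagr f g A x (dualUpdate f g A p r lam x y) +
          epiPhi p r lam (y - dualUpdate f g A p r lam x y) := by
    intro x' hx'
    have h := he.2.2 x'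
    beta_reduce at h
    rw [haug x hx, haug x' hx', ← EReal.coe_add, EReal.coe_le_coe_iff] at h
    linarith
  have hinner : ∀ x' ∈ dom f, -ε ≤ inner ℝ e (x' - x) := by
    intro x' hx'
    have h1 := (abs_le.1 (abs_real_inner_le_norm e (x' - x))).1
    have h2 : ‖e‖ * ‖x' - x‖ ≤ ‖e‖ * Metric.diam (dom f) := by
      rw [← dist_eq_norm]
      exact mul_le_mul_of_nonneg_left (Metric.dist_le_diam_of_mem hbd hx' hx) (norm_nonneg _)
    linarith
  constructor
  · rw [lagr_of_mem hf hg hx (hs x hx).1, le_iInf_add_coe_iff]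
    intro x'
    by_cases hx' : x' ∈ dom f
    · rw [lagr_of_mem hf hg hx' (hs x hx).1, EReal.coe_le_coe_iff]
      linarith [inner_le_lagr_sub hf hg hL hp hr hlam hs hx hsub x' hx', hinner x' hx']
    · rw [lagr_of_notMem hx']
      exact le_top
  · rw [haug x hx, le_iInf_add_coe_iff]
    intro x'
    by_cases hx' : x' ∈ dom f
    · rw [haug x' hx', EReal.coe_le_coe_iff]
      linarith [hsub x' hx', hinner x' hx']
    · rw [augLagr_of_notMem hx']
      exact le_top

end InexactUpdates

end PowerALM

theorem mainTheorem4 {n m : ℕ}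
    (f : EuclideanSpace ℝ (Fin n) → EReal) (g : EuclideanSpace ℝ (Fin m) → EReal)
    (A : EuclideanSpace ℝ (Fin n) → EuclideanSpace ℝ (Fin m))
    (hf : PowerALM.IsGammaZero f) (hg : PowerALM.IsGammaZero g)
    (hL : ∀ y, PowerALM.ConvexFun (fun x => PowerALM.lagr f g A x y))
    (p r lam ε : ℝ) (hp : 1 ≤ p) (hr : r = 2 ∨ r = p + 1) (hlam : 0 < lam) (hε : 0 ≤ ε)
    (xp : EuclideanSpace ℝ (Fin n)) (y yp : EuclideanSpace ℝ (Fin m))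
    (hyp : yp = PowerALM.dualUpdate f g A p r lam xp y) :
    -- the gradients in the dual update exist
    ((∀ v : EuclideanSpace ℝ (Fin m),
        PowerALM.phiConj p r v ≠ ⊤ ∧ PowerALM.phiConj p r v ≠ ⊥) ∧
      Differentiable ℝ
        (fun v : EuclideanSpace ℝ (Fin m) => (PowerALM.phiConj p r v).toReal) ∧
      (xp ∈ PowerALM.dom f →
        (∀ z, PowerALM.augLagr f g A p r lam xp z ≠ ⊤ ∧
          PowerALM.augLagr f g A p r lam xp z ≠ ⊥) ∧
        Differentiable ℝ (fun z => (PowerALM.augLagr f g A p r lam xp z).toReal))) ∧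
    -- (i)
    (PowerALM.lagr f g A xp yp ≤ (⨅ x, PowerALM.lagr f g A x yp) + (ε : EReal) →
      xp ∈ PowerALM.dom f ∧
      - PowerALM.gradAugLagr f g A p r lam xp y ∈
        PowerALM.epsSubdiff ε (PowerALM.negDual f g A) yp) ∧
    -- (ii)
    (PowerALM.augLagr f g A p r lam xp y ≤
        (⨅ x, PowerALM.augLagr f g A p r lam x y) + (ε : EReal) →
      xp ∈ PowerALM.dom f ∧
      PowerALM.IsEpsProximalPoint p r lam ((2 : ℝ) ^ (p - 1) * ε)
        (PowerALM.negDual f g A) y yp) ∧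
    -- (iii)
    (Bornology.IsBounded (PowerALM.dom f) →
      ∀ e ∈ PowerALM.subdiff (fun x => PowerALM.augLagr f g A p r lam x y) xp,
        ‖e‖ * Metric.diam (PowerALM.dom f) ≤ ε →
        PowerALM.lagr f g A xp yp ≤ (⨅ x, PowerALM.lagr f g A x yp) + (ε : EReal) ∧
        PowerALM.augLagr f g A p r lam xp y ≤
          (⨅ x, PowerALM.augLagr f g A p r lam x y) + (ε : EReal)) := by
  have hφ := PowerALM.isProxFunction_phi (m := m) hp hr
  refine ⟨⟨fun v => ?_, fun v => ?_, fun hx => ⟨fun z => ?_, fun z => ?_⟩⟩, fun h => ?_,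
    fun h => ?_, fun hbd e he heε => ?_⟩
  · obtain ⟨u, rfl⟩ := hφ.surjective_grad v
    rw [PowerALM.phiConj, hφ.conj_grad]
    exact ⟨EReal.coe_ne_top _, EReal.coe_ne_bot _⟩
  · obtain ⟨u, rfl⟩ := hφ.surjective_grad v
    exact (hφ.hasGradientAt_conj u).differentiableAt
  · rw [(PowerALM.isDualUpdate_dualUpdate hf hg hp hr hlam hx z).augLagr_eq hf hg hp hr hlam hx]
    exact ⟨EReal.coe_ne_top _, EReal.coe_ne_bot _⟩
  · exact ((PowerALM.isDualUpdate_dualUpdate hf hg hp hr hlam hx z).hasGradientAt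
      hf hg hp hr hlam hx).differentiableAt
  · have hx := PowerALM.mem_dom_of_lagr_lt_top
      (PowerALM.mem_dom_of_le_iInf_add (hf.dom_lagr_nonempty hg yp) h)
    subst hyp
    exact ⟨hx, (PowerALM.isDualUpdate_dualUpdate hf hg hp hr hlam hx y).mem_epsSubdiff
      hf hg hp hr hlam hx h⟩
  · have hx := PowerALM.mem_dom_of_augLagr_lt_top
      (PowerALM.mem_dom_of_le_iInf_add (PowerALM.dom_augLagr_nonempty hf hg hp hr hlam y) h)
    subst hyp
    exact ⟨hx, PowerALM.isEpsProximalPoint_dualUpdate hf hg hL hp hr hlam hx h⟩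
  · subst hyp
    exact PowerALM.approx_min_of_mem_subdiff hf hg hL hp hr hlam hbd he heε
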